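/- \textbf{Theorem (UES and ISS under hybrid persistency of excitation).} Let $\mathcal T\subset\mathbb R_{\ge 0}\times\mathbb Z_{\ge 0}$ be a hybrid time domain: $(0,0)\in\mathcal T$, any two points of $\mathcal T$ are comparable in the product order, and for each $(T,J)\in\mathcal T$ one has $\mathcal T\cap([0,T]\times\{0,\dots,J\})=\bigcup_{j=0}^{J}[t_j,t_{j+1}]\times\{j\}$ for some $0=t_0\le t_1\le\dots\le t_{J+1}=T$. Put $I^j:=\{t:(t,j)\in\mathcal T\}$. Let $A,B:\mathcal T\to\mathbb R^{n\times n}$, with $t\mapsto A(t,j)$ measurable on $I^j$ for each $j$; let $|\cdot|$ denote the Euclidean norm and the induced matrix norm. For $\nu:\mathcal T\to\mathbb R^n$ consider the hybrid system $$\mathcal H'_\nu:\quad \dot\zeta=-A(t,j)\zeta+\nu(t,j)\ \ \text{for } t\in\mathrm{int}(I^j),\qquad \zeta^+=[I-B(t,j)]\zeta+\nu(t,j)\ \ \text{for }(t,j),(t,j+1)\in\mathcal T.$$ A solution starting at $(t_o,j_o)\in\mathcal T$ from $\zeta_o$ is a function $\zeta$ on a hybrid time domain $\mathrm{dom}\,\zeta\subset\mathcal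 T$ starting at $(t_o,j_o)$ (same definition, with $(t_o,j_o)$ in place of $(0,0)$), with $\zeta(t_o,j_o)=\zeta_o$, such that each $t\mapsto\zeta(t,j)$ is locally absolutely continuous on $\{t:(t,j)\in\mathrm{dom}\,\zeta\}$ and satisfies the differential equation for almost every $t$ in the interior of this interval, and such that $\zeta(t,j+1)=[I-B(t,j)]\zeta(t,j)+\nu(t,j)$ whenever $(t,j),(t,j+1)\in\mathrm{dom}\,\zeta$. Solutions need not be maximal. Assume that $A$ and $B$ are bounded on $\mathcal T$ and that, for all $(t,j)\in\mathcal T$, $A(t,j)=A(t,j)^\top\ge 0$, $B(t,j)=B(t,j)^\top\ge 0$ and $|B(t,j)|\le 1$. Assume moreover that $(A,B)$ is hybrid persistently exciting (HPE): there exist $K,\mu>0$ such that for each $(t_o,j_o)\in\mathcal T$ there is a point of $\mathcal T$ at or after $(t_o,j_o)$ whose hybrid distance $(s-t_o)+(m-j_o)$ from $(t_o,j_o)$ is at least $K$ (so $\mathcal T$ is unbounded) and, $(s_K,m_K)$ being the first such point and $\bigcup_{i=j_o}^{m_K}[t_i,t_{i+1}]\times\{i\}$, with $t_{j_o}=t_o$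 and $t_{m_K+1}=s_K$, being the part of $\mathcal T$ between $(t_o,j_o)$ and $(s_K,m_K)$, $$\sum_{i=j_o}^{m_K}\int_{t_i}^{t_{i+1}}\Phi_{AB}(s,i)\,ds+\sum_{i=j_o}^{m_K-1}\Phi_{AB}(t_{i+1},i)\ \ge\ \mu I,$$ where $\Phi_{AB}(t,j):=A(t,j)$ if $t\in\mathrm{int}(I^j)$ and $\Phi_{AB}(t,j):=B(t,j)$ otherwise. Then: (i) the origin is uniformly exponentially stable for $\mathcal H'_0$: there exist $\kappa,\lambda>0$ such that every solution of $\mathcal H'_0$, from any $\zeta_o$ at any $(t_o,j_o)\in\mathcal T$, satisfies $$|\zeta(t,j)|\le\kappa|\zeta_o|e^{-\lambda(t+j-t_o-j_o)}\qquad\forall (t,j)\in\mathrm{dom}\,\zeta;$$ (ii) $\mathcal H'_\nu$ is input-to-state stable with respect to $\nu$: there exist $\alpha$ of class $\mathcal K_\infty$ and $\beta$ of class $\mathcal{KL}$ such that, for every $\nu$, every solution of $\mathcal H'_\nu$, from any $\zeta_o$ at any $(t_o,j_o)\in\mathcal T$, satisfies $$|\zeta(t,j)|\le\beta(|\zeta_o|,t+j-t_o-j_o)+\alpha\big(\sup\{|\nu(s,i)|:(s,i)\in\mathrm{dom}\,\zeta,\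 (s,i)\text{ strictly before }(t,j)\}\big)\qquad\forall (t,j)\in\mathrm{dom}\,\zeta,$$ where $\sup\emptyset=0$, and the estimate is void where the supremum is infinite. -/

import Mathlib

namespace HybridPE

open MeasureTheory Set Filter Topology
open scoped Matrix.Norms.L2Operator

noncomputable section

/-- Hybrid time `(t, j) : ℝ × ℕ` carries the product order.
`IsHybridTimeDomainFrom t₀ j₀ E`: the set `E` is a hybrid time domain starting at `(t₀, j₀)`, i.e.
every truncation `E ∩ ([t₀, T] × {j₀, …, J})` at a point `(T, J)` of `E` is a finite union
`⋃_{i = j₀}^{J} [τ i, τ (i+1)] × {i}` with `t₀ = τ j₀ ≤ τ (j₀+1) ≤ … ≤ τ (J+1) = T`.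
The field `chain` (any two hybrid times are comparable) excludes branching sets such as
`[0, 1] × {0} ∪ {(1/2, 1)}`, all of whose truncations have the required form. -/
structure IsHybridTimeDomainFrom (t₀ : ℝ) (j₀ : ℕ) (E : Set (ℝ × ℕ)) : Prop where
  start_mem : (t₀, j₀) ∈ E
  start_le : ∀ p ∈ E, (t₀, j₀) ≤ p
  chain : ∀ p ∈ E, ∀ q ∈ E, p ≤ q ∨ q ≤ p
  truncation : ∀ T : ℝ, ∀ J : ℕ, (T, J) ∈ E → ∃ τ : ℕ → ℝ,
    τ j₀ = t₀ ∧ τ (J + 1) = T ∧ (∀ i ∈ Finset.Icc j₀ J, τ i ≤ τ (i + 1)) ∧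
    E ∩ Icc (t₀, j₀) (T, J) = ⋃ i ∈ Finset.Icc j₀ J, Icc (τ i) (τ (i + 1)) ×ˢ {i}

/-- A hybrid time domain: a subset of `ℝ≥0 × ℕ`, starting at `(0, 0)`. -/
def IsHybridTimeDomain (E : Set (ℝ × ℕ)) : Prop :=
  IsHybridTimeDomainFrom 0 0 E

/-- The interval `I^j = {t : (t, j) ∈ E}`. -/
def flowInterval (E : Set (ℝ × ℕ)) (j : ℕ) : Set ℝ :=
  {t | (t, j) ∈ E}

/-- `ζ` is a hybrid arc on `E`: for each `j` the map `t ↦ ζ(t, j)` is locally absolutely continuous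
on `I^j`, i.e. absolutely continuous on every compact interval contained in `I^j`. -/
def IsHybridArc {X : Type*} [PseudoMetricSpace X] (E : Set (ℝ × ℕ)) (ζ : ℝ → ℕ → X) : Prop :=
  ∀ j : ℕ, ∀ a b : ℝ, a ≤ b → Icc a b ⊆ flowInterval E j →
    AbsolutelyContinuousOnInterval (fun t => ζ t j) a b

/-- `(m, τ)` describes `E_{t,j,K}`, the shortest hybrid time domain starting from `(t, j)`, contained
in `D` and of length at least `K`: it is `⋃_{i = j}^{m} [τ i, τ (i+1)] × {i}`, with `τ j = t` and
last point `(τ (m+1), m)`, which is the least point of `D` at hybrid distance at least `K`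
after `(t, j)`. -/
structure IsShortestWindow (D : Set (ℝ × ℕ)) (t : ℝ) (j : ℕ) (K : ℝ) (m : ℕ) (τ : ℕ → ℝ) :
    Prop where
  le : j ≤ m
  start_eq : τ j = t
  mono : ∀ i ∈ Finset.Icc j m, τ i ≤ τ (i + 1)
  end_mem : (τ (m + 1), m) ∈ D
  eq_union : D ∩ Icc (t, j) (τ (m + 1), m) =
    ⋃ i ∈ Finset.Icc j m, Icc (τ i) (τ (i + 1)) ×ˢ {i}
  length : K ≤ (τ (m + 1) - t) + ((m : ℝ) - (j : ℝ))
  shortest : ∀ s : ℝ, ∀ k : ℕ, (s, k) ∈ D → (t, j) ≤ (s, k) →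
    K ≤ (s - t) + ((k : ℝ) - (j : ℝ)) → (τ (m + 1), m) ≤ (s, k)

/-- The hybrid integral of `φ` over `⋃_{i = j}^{m} [τ i, τ (i+1)] × {i}`:
`∑_{i=j}^{m} ∫_{τ i}^{τ (i+1)} φ(s, i) ds + ∑_{i=j}^{m-1} φ(τ (i+1), i)`. -/
def hybridIntegral {X : Type*} [NormedAddCommGroup X] [NormedSpace ℝ X]
    (φ : ℝ → ℕ → X) (j m : ℕ) (τ : ℕ → ℝ) : X :=
  (∑ i ∈ Finset.Icc j m, ∫ s in (τ i)..(τ (i + 1)), φ s i) +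
    ∑ i ∈ Finset.Ico j m, φ (τ (i + 1)) i

variable {n : ℕ}

open Classical in
/-- `Φ_{AB}(t, j)` is `A(t, j)` if `t ∈ int(I^j)`, and `B(t, j)` otherwise. -/
def PhiAB (D : Set (ℝ × ℕ)) (A B : ℝ → ℕ → Matrix (Fin n) (Fin n) ℝ) (t : ℝ) (j : ℕ) :
    Matrix (Fin n) (Fin n) ℝ :=
  if t ∈ interior (flowInterval D j) then A t j else B t j

/-- Hybrid persistency of excitation of `(A, B)` on the common hybrid time domain `D`: there are
`K, μ > 0` such that, for each `(t₀, j₀) ∈ D`, the window `E_{t₀,j₀,K}` exists and the hybrid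
integral of `Φ_{AB}` over it is `≥ μ I` in the Loewner order. -/
def HPE (D : Set (ℝ × ℕ)) (A B : ℝ → ℕ → Matrix (Fin n) (Fin n) ℝ) : Prop :=
  ∃ K > (0 : ℝ), ∃ μ > (0 : ℝ), ∀ t₀ : ℝ, ∀ j₀ : ℕ, (t₀, j₀) ∈ D →
    ∃ m : ℕ, ∃ τ : ℕ → ℝ, IsShortestWindow D t₀ j₀ K m τ ∧
      (hybridIntegral (PhiAB D A B) j₀ m τ - μ • (1 : Matrix (Fin n) (Fin n) ℝ)).PosSemidef

/-- For each `j`, the map `t ↦ M(t, j)` is (Lebesgue-a.e. strongly) measurable on `I^j`. -/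
def FlowMeasurable (D : Set (ℝ × ℕ)) (M : ℝ → ℕ → Matrix (Fin n) (Fin n) ℝ) : Prop :=
  ∀ j : ℕ, AEStronglyMeasurable (fun t => M t j) (volume.restrict (flowInterval D j))

/-- `M` is bounded on `D`, in the operator norm induced by the Euclidean norm. -/
def UniformlyBounded (D : Set (ℝ × ℕ)) (M : ℝ → ℕ → Matrix (Fin n) (Fin n) ℝ) : Prop :=
  ∃ c > (0 : ℝ), ∀ t : ℝ, ∀ j : ℕ, (t, j) ∈ D → ‖M t j‖ ≤ c

/-- On `D`: `A = Aᵀ ≥ 0`, `B = Bᵀ ≥ 0` and `|B| ≤ 1` (operator norm induced by the Euclidean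
norm). `Matrix.PosSemidef` includes symmetry. -/
def StructuralProperties (D : Set (ℝ × ℕ)) (A B : ℝ → ℕ → Matrix (Fin n) (Fin n) ℝ) : Prop :=
  ∀ t : ℝ, ∀ j : ℕ, (t, j) ∈ D → (A t j).PosSemidef ∧ (B t j).PosSemidef ∧ ‖B t j‖ ≤ 1

/-- `ζ`, with hybrid time domain `E ⊆ D`, is a solution starting at `(t₀, j₀)` of
`ζ̇ = -A(t, j) ζ + ν(t, j)` during flows, `ζ⁺ = (I - B(t, j)) ζ + ν(t, j)` at jumps.
The initial value is `ζ t₀ j₀`; solutions need not be maximal. -/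
structure IsSolution (D : Set (ℝ × ℕ)) (A B : ℝ → ℕ → Matrix (Fin n) (Fin n) ℝ)
    (ν : ℝ → ℕ → EuclideanSpace ℝ (Fin n)) (t₀ : ℝ) (j₀ : ℕ)
    (E : Set (ℝ × ℕ)) (ζ : ℝ → ℕ → EuclideanSpace ℝ (Fin n)) : Prop where
  subset : E ⊆ D
  domain : IsHybridTimeDomainFrom t₀ j₀ E
  arc : IsHybridArc E ζ
  flow : ∀ j : ℕ, ∀ᵐ t : ℝ, t ∈ interior (flowInterval E j) →
    HasDerivAt (fun s => ζ s j) (-(Matrix.toEuclideanCLM (𝕜 := ℝ) (A t j) (ζ t j)) + ν t j) t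
  jump : ∀ t : ℝ, ∀ j : ℕ, (t, j) ∈ E → (t, j + 1) ∈ E →
    ζ t (j + 1) = Matrix.toEuclideanCLM (𝕜 := ℝ) (1 - B t j) (ζ t j) + ν t j

/-- Uniform exponential stability of the origin for the unperturbed system (`ν ≡ 0`), with
constants independent of the solution and of its initial hybrid time. -/
def OriginUES (D : Set (ℝ × ℕ)) (A B : ℝ → ℕ → Matrix (Fin n) (Fin n) ℝ) : Prop :=
  ∃ κ > (0 : ℝ), ∃ lam > (0 : ℝ), ∀ (t₀ : ℝ) (j₀ : ℕ) (E : Set (ℝ × ℕ))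
    (ζ : ℝ → ℕ → EuclideanSpace ℝ (Fin n)), IsSolution D A B (fun _ _ => 0) t₀ j₀ E ζ →
    ∀ t : ℝ, ∀ j : ℕ, (t, j) ∈ E →
      ‖ζ t j‖ ≤ κ * ‖ζ t₀ j₀‖ * Real.exp (-lam * (t + (j : ℝ) - t₀ - (j₀ : ℝ)))

/-- Class `𝒦` functions on `[0, ∞)`. -/
structure IsClassK (α : ℝ → ℝ) : Prop where
  zero : α 0 = 0
  continuousOn : ContinuousOn α (Ici 0)
  strictMonoOn : StrictMonoOn α (Ici 0)

/-- Class `𝒦_∞` functions on `[0, ∞)`. -/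
structure IsClassKInfty (α : ℝ → ℝ) : Prop extends IsClassK α where
  tendsto_atTop : Tendsto α atTop atTop

/-- Class `𝒦ℒ` functions on `[0, ∞) × [0, ∞)`. -/
structure IsClassKL (β : ℝ → ℝ → ℝ) : Prop where
  continuousOn : ContinuousOn (fun p : ℝ × ℝ => β p.1 p.2) (Ici 0 ×ˢ Ici 0)
  classK : ∀ s ∈ Ici (0 : ℝ), IsClassK (fun r => β r s)
  antitoneOn : ∀ r ∈ Ici (0 : ℝ), AntitoneOn (β r) (Ici 0)
  tendsto_zero : ∀ r ∈ Ici (0 : ℝ), Tendsto (β r) atTop (𝓝 0)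

/-- The values `|ν(s, i)|` at the hybrid times `(s, i) ∈ E` that precede `(t, j)`, i.e. on
`E \ E_{t,j,∞}`. -/
def pastInput (E : Set (ℝ × ℕ)) (ν : ℝ → ℕ → EuclideanSpace ℝ (Fin n)) (t : ℝ) (j : ℕ) : Set ℝ :=
  {r | ∃ s : ℝ, ∃ i : ℕ, (s, i) ∈ E ∧ ¬ (t, j) ≤ (s, i) ∧ r = ‖ν s i‖}

/-- Input-to-state stability with respect to `ν`, with gains independent of the input, of the
solution and of its initial hybrid time. When the supremum of the past input is infinite the
estimate is void; the supremum over the empty set is `0`. -/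
def ISS (D : Set (ℝ × ℕ)) (A B : ℝ → ℕ → Matrix (Fin n) (Fin n) ℝ) : Prop :=
  ∃ α : ℝ → ℝ, ∃ β : ℝ → ℝ → ℝ, IsClassKInfty α ∧ IsClassKL β ∧
    ∀ (ν : ℝ → ℕ → EuclideanSpace ℝ (Fin n)) (t₀ : ℝ) (j₀ : ℕ) (E : Set (ℝ × ℕ))
      (ζ : ℝ → ℕ → EuclideanSpace ℝ (Fin n)), IsSolution D A B ν t₀ j₀ E ζ →
      ∀ t : ℝ, ∀ j : ℕ, (t, j) ∈ E → BddAbove (pastInput E ν t j) →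
        ‖ζ t j‖ ≤ β ‖ζ t₀ j₀‖ (t + (j : ℝ) - t₀ - (j₀ : ℝ)) + α (sSup (pastInput E ν t j))

end

end HybridPE

/-!
The squared norm `|ζ|²` is a Lyapunov function. The matrix `Φ_{AB}` plays the same role along flows
and at jumps: `ζ` moves with rate `-Φ_{AB} ζ + ν`, and since `Φ_{AB}` is positive semidefinite, and
at most `I` at jumps, `|ζ|²` decreases at least by the hybrid integral `δ` of `⟪ζ, Φ_{AB} ζ⟫`, up
to terms in the input (`DampedPath.norm_sq_end_le_sub_dissipation`). All such statements come from
one inequality for hybrid arcs, `sub_le_hybridIntegral`.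

The dissipated energy `δ` over an exciting window cannot be small. As `|Φ_{AB} ζ|²` is at most a
constant times `⟪ζ, Φ_{AB} ζ⟫`, an arc that dissipates little stays close to its initial value `ζ₀`
(`DampedPath.norm_sub_sq_end_le`); hence the hybrid integral of `⟪ζ₀, Φ_{AB} ζ₀⟫`, which is at least
`μ |ζ₀|²`, is at most a constant times `δ`, up to the input
(`DampedPath.hybridIntegral_inner_start_le`). So `|ζ|²` contracts over each window by a fixed factor
`ρ < 1`, up to a multiple of the squared bound `M²` of the input (`DampedPath.exists_contraction`).

The windows have length at least `K` and at most `K + 1` (`IsShortestWindow.length_le`), so iterating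
the contraction gives exponential decay in hybrid time. In the last, incomplete window the growth
estimate `DampedPath.norm_sq_end_le` suffices. The resulting bound
`|ζ| ≤ κ |ζ₀| exp (-lam d) + γ M`, with `d` the elapsed hybrid time, is the input-to-state estimate,
and is exponential stability when `M = 0`.
-/

namespace HybridPE

open MeasureTheory Set Filter Topology
open scoped Matrix.Norms.L2Operator RealInnerProductSpace

noncomputable section

/-! ### Hybrid integrals and the fundamental inequality for hybrid arcs -/

section HybridIntegral

variable {φ ψ : ℝ → ℕ → ℝ} {j m : ℕ} {τ : ℕ → ℝ}

/-- `φ` is integrable on each piece `[τ i, τ (i+1)] × {i}`, `j ≤ i ≤ m`. -/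
def HybridIntegrable {X : Type*} [NormedAddCommGroup X] (φ : ℝ → ℕ → X) (j m : ℕ) (τ : ℕ → ℝ) :
    Prop :=
  ∀ i ∈ Finset.Icc j m, IntervalIntegrable (fun s => φ s i) volume (τ i) (τ (i + 1))

theorem HybridIntegrable.add (hφ : HybridIntegrable φ j m τ) (hψ : HybridIntegrable ψ j m τ) :
    HybridIntegrable (fun t i => φ t i + ψ t i) j m τ :=
  fun i hi => (hφ i hi).add (hψ i hi)

theorem HybridIntegrable.const_mul (hφ : HybridIntegrable φ j m τ) (a : ℝ) :
    HybridIntegrable (fun t i => a * φ t i) j m τ :=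
  fun i hi => (hφ i hi).const_mul a

theorem hybridIntegrable_const (a : ℝ) : HybridIntegrable (fun _ _ => a) j m τ :=
  fun _ _ => intervalIntegrable_const

theorem hybridIntegral_add (hφ : HybridIntegrable φ j m τ) (hψ : HybridIntegrable ψ j m τ) :
    hybridIntegral (fun t i => φ t i + ψ t i) j m τ =
      hybridIntegral φ j m τ + hybridIntegral ψ j m τ := by
  unfold hybridIntegral
  rw [Finset.sum_congr rfl fun i hi => intervalIntegral.integral_add (hφ i hi) (hψ i hi),
    Finset.sum_add_distrib, Finset.sum_add_distrib]
  ring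

theorem hybridIntegral_const_mul (a : ℝ) :
    hybridIntegral (fun t i => a * φ t i) j m τ = a * hybridIntegral φ j m τ := by
  simp only [hybridIntegral, intervalIntegral.integral_const_mul, mul_add, Finset.mul_sum]

theorem hybridIntegral_const (hjm : j ≤ m) (a : ℝ) :
    hybridIntegral (fun _ _ => a) j m τ = (τ (m + 1) - τ j + ((m : ℝ) - j)) * a := by
  unfold hybridIntegral
  simp only [intervalIntegral.integral_const, smul_eq_mul, Finset.sum_const, nsmul_eq_mul,
    Nat.card_Ico, ← Finset.sum_mul]
  rw [Nat.cast_sub hjm, ← Finset.Ico_add_one_right_eq_Icc, Finset.sum_Ico_sub τ (by lia)]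
  ring

theorem hybridIntegral_mono (hτ : ∀ i ∈ Finset.Icc j m, τ i ≤ τ (i + 1))
    (hφ : HybridIntegrable φ j m τ) (hψ : HybridIntegrable ψ j m τ)
    (hflow : ∀ i ∈ Finset.Icc j m, ∀ t ∈ Ioo (τ i) (τ (i + 1)), φ t i ≤ ψ t i)
    (hjump : ∀ i ∈ Finset.Ico j m, φ (τ (i + 1)) i ≤ ψ (τ (i + 1)) i) :
    hybridIntegral φ j m τ ≤ hybridIntegral ψ j m τ :=
  add_le_add
    (Finset.sum_le_sum fun i hi => intervalIntegral.integral_mono_on_of_le_Ioo (hτ i hi)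
      (hφ i hi) (hψ i hi) (hflow i hi))
    (Finset.sum_le_sum hjump)

/-- The hybrid integral of a nonnegative function increases when the path is prolonged. -/
theorem hybridIntegral_update_le {k : ℕ} {s : ℝ} (hτ : ∀ i ∈ Finset.Icc j m, τ i ≤ τ (i + 1))
    (hφ : HybridIntegrable φ j m τ)
    (hflow : ∀ i ∈ Finset.Icc j m, ∀ t ∈ Ioo (τ i) (τ (i + 1)), 0 ≤ φ t i)
    (hjump : ∀ i ∈ Finset.Ico j m, 0 ≤ φ (τ (i + 1)) i)
    (hk : k ∈ Finset.Icc j m) (hs : s ∈ Icc (τ k) (τ (k + 1))) :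
    hybridIntegral φ j k (Function.update τ (k + 1) s) ≤ hybridIntegral φ j m τ := by
  obtain ⟨hjk, hkm⟩ := Finset.mem_Icc.1 hk
  have hpos : ∀ i ∈ Finset.Icc j m, 0 ≤ ∫ t in (τ i)..(τ (i + 1)), φ t i := fun i hi => by
    simpa using intervalIntegral.integral_mono_on_of_le_Ioo (hτ i hi)
      intervalIntegrable_const (hφ i hi) (hflow i hi)
  unfold hybridIntegral
  refine add_le_add ?_ ?_
  · refine le_trans (Finset.sum_le_sum fun i hi => ?_)
      (Finset.sum_le_sum_of_subset_of_nonneg (Finset.Icc_subset_Icc_right hkm)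
        fun i hi _ => hpos i hi)
    have hik : i ≤ k := (Finset.mem_Icc.1 hi).2
    rw [Function.update_of_ne (by lia)]
    obtain rfl | hne := eq_or_ne i k
    · have hint := hφ i hk
      have h1 : IntervalIntegrable (fun t => φ t i) volume (τ i) s :=
        hint.mono_set (by rw [uIcc_of_le hs.1, uIcc_of_le (hτ i hk)]; exact Icc_subset_Icc_right hs.2)
      have h2 : IntervalIntegrable (fun t => φ t i) volume s (τ (i + 1)) :=
        hint.mono_set (by rw [uIcc_of_le hs.2, uIcc_of_le (hτ i hk)]; exact Icc_subset_Icc_left hs.1)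
      rw [Function.update_self, ← intervalIntegral.integral_add_adjacent_intervals h1 h2]
      have := intervalIntegral.integral_mono_on_of_le_Ioo hs.2
        (intervalIntegrable_const (c := (0 : ℝ))) h2
        fun t ht => hflow i hk t ⟨hs.1.trans_lt ht.1, ht.2⟩
      simpa using this
    · rw [Function.update_of_ne (by lia)]
  · refine le_trans (le_of_eq (Finset.sum_congr rfl fun i hi => ?_))
      (Finset.sum_le_sum_of_subset_of_nonneg (Finset.Ico_subset_Ico_right hkm)
        fun i hi _ => hjump i hi)
    rw [Function.update_of_ne (by have := (Finset.mem_Ico.1 hi).2; lia)]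

/-- An absolutely continuous function grows at most by the integral of any integrable majorant of
its derivative. -/
theorem sub_le_integral_of_absolutelyContinuous {f g : ℝ → ℝ} {a b : ℝ} (hab : a ≤ b)
    (hf : AbsolutelyContinuousOnInterval f a b) (hg : IntervalIntegrable g volume a b)
    (hfg : ∀ᵐ t : ℝ, t ∈ Ioo a b → ∃ f', HasDerivAt f f' t ∧ f' ≤ g t) :
    f b - f a ≤ ∫ t in a..b, g t := by
  rw [← hf.integral_deriv_eq_sub]
  refine intervalIntegral.integral_mono_ae_restrict hab hf.intervalIntegrable_deriv hg ?_
  rw [← Measure.restrict_congr_set Ioo_ae_eq_Icc]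
  refine (ae_restrict_iff' measurableSet_Ioo).2 ?_
  filter_upwards [hfg] with t ht hmem
  obtain ⟨f', hf', hle⟩ := ht hmem
  rwa [hf'.deriv]

/-- Fundamental inequality for hybrid arcs: if `φ` bounds the derivative of `f` along flows and the
increment of `f` at jumps, then the hybrid integral of `φ` bounds the total increment of `f`. -/
theorem sub_le_hybridIntegral {f : ℝ → ℕ → ℝ} (hjm : j ≤ m)
    (hτ : ∀ i ∈ Finset.Icc j m, τ i ≤ τ (i + 1))
    (hf : ∀ i ∈ Finset.Icc j m, AbsolutelyContinuousOnInterval (fun t => f t i) (τ i) (τ (i + 1)))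
    (hφ : HybridIntegrable φ j m τ)
    (hflow : ∀ i ∈ Finset.Icc j m, ∀ᵐ t : ℝ, t ∈ Ioo (τ i) (τ (i + 1)) →
      ∃ f', HasDerivAt (fun s => f s i) f' t ∧ f' ≤ φ t i)
    (hjump : ∀ i ∈ Finset.Ico j m, f (τ (i + 1)) (i + 1) - f (τ (i + 1)) i ≤ φ (τ (i + 1)) i) :
    f (τ (m + 1)) m - f (τ j) j ≤ hybridIntegral φ j m τ := by
  have hsum : f (τ (m + 1)) m - f (τ j) j =
      ∑ i ∈ Finset.Icc j m, (f (τ (i + 1)) i - f (τ i) i) +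
        ∑ i ∈ Finset.Ico j m, (f (τ (i + 1)) (i + 1) - f (τ (i + 1)) i) := by
    clear hτ hf hφ hflow hjump
    induction m, hjm using Nat.le_induction with
    | base => simp
    | succ k hk ih =>
      rw [← Finset.insert_Icc_right_eq_Icc_add_one (by lia), Finset.sum_insert (by simp),
        Finset.sum_Ico_succ_top hk]
      linarith
  rw [hsum]
  exact add_le_add (Finset.sum_le_sum fun i hi =>
    sub_le_integral_of_absolutelyContinuous (hτ i hi) (hf i hi) (hφ i hi) (hflow i hi))
    (Finset.sum_le_sum hjump)

end HybridIntegral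

/-! ### Positive operators -/

section PositiveOperator

variable {H : Type*} [NormedAddCommGroup H] [InnerProductSpace ℝ H] {T : H →L[ℝ] H}

theorem inner_apply_nonneg (hT : T.IsPositive) (x : H) : 0 ≤ ⟪x, T x⟫ := by
  rw [real_inner_comm]; exact hT.2 x

theorem inner_apply_le {c : ℝ} (hc : ‖T‖ ≤ c) (x : H) : ⟪x, T x⟫ ≤ c * ‖x‖ ^ 2 := by
  have h1 := real_inner_le_norm x (T x)
  have h2 := (T.le_opNorm x).trans (mul_le_mul_of_nonneg_right hc (norm_nonneg x))
  nlinarith [mul_le_mul_of_nonneg_left h2 (norm_nonneg x)]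

theorem inner_apply_le_two_mul_add (hT : T.IsPositive) (x y : H) :
    ⟪x, T x⟫ ≤ 2 * ⟪y, T y⟫ + 2 * ⟪y - x, T (y - x)⟫ := by
  -- the parallelogram identity, with `0 ≤ ⟪2 • y - x, T (2 • y - x)⟫`
  have h := inner_apply_nonneg hT (y + (y - x))
  have e : ⟪x, T x⟫ = ⟪y - (y - x), T (y - (y - x))⟫ := by simp
  rw [e]
  simp only [map_add, map_sub, inner_add_left, inner_add_right, inner_sub_left,
    inner_sub_right] at h ⊢
  linarith

theorem norm_apply_sq_le {c : ℝ} (hT : T.IsPositive) (hc0 : 0 < c) (hc : ‖T‖ ≤ c) (x : H) :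
    ‖T x‖ ^ 2 ≤ c * ⟪x, T x⟫ := by
  -- positivity of the quadratic form at `x - c⁻¹ • T x`
  have h := inner_apply_nonneg hT (x - c⁻¹ • T x)
  have h2 := inner_apply_le hc (T x)
  have hsymm : ⟪x, T (T x)⟫ = ⟪T x, T x⟫ := (hT.1 x (T x)).symm
  simp only [map_sub, map_smul, inner_sub_left, inner_sub_right, inner_smul_left,
    inner_smul_right, hsymm, real_inner_self_eq_norm_sq, conj_trivial] at h
  have h3 : c⁻¹ * (c⁻¹ * ⟪T x, T (T x)⟫) ≤ c⁻¹ * ‖T x‖ ^ 2 := by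
    refine mul_le_mul_of_nonneg_left ?_ (by positivity)
    calc c⁻¹ * ⟪T x, T (T x)⟫ ≤ c⁻¹ * (c * ‖T x‖ ^ 2) := by gcongr
      _ = ‖T x‖ ^ 2 := by field_simp
  have h4 : c⁻¹ * ‖T x‖ ^ 2 ≤ ⟪x, T x⟫ := by linarith
  calc ‖T x‖ ^ 2 = c * (c⁻¹ * ‖T x‖ ^ 2) := by field_simp
    _ ≤ c * ⟪x, T x⟫ := by gcongr

theorem norm_sub_apply_sq_le (hT : T.IsPositive) (h1 : ‖T‖ ≤ 1) (x : H) :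
    ‖x - T x‖ ^ 2 ≤ ‖x‖ ^ 2 - ⟪x, T x⟫ := by
  have := norm_apply_sq_le hT one_pos h1 x
  rw [norm_sub_sq_real]
  linarith

end PositiveOperator

/-! ### Damped paths -/

section DampedPath

theorem monotoneOn_of_steps {j m : ℕ} {τ : ℕ → ℝ} (hτ : ∀ i ∈ Finset.Icc j m, τ i ≤ τ (i + 1)) :
    MonotoneOn τ (Icc j (m + 1)) :=
  monotoneOn_of_le_add_one ordConnected_Icc fun i _ hi hi' =>
    hτ i (Finset.mem_Icc.2 ⟨hi.1, by have := hi'.2; lia⟩)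

theorem _root_.LipschitzWith.comp_absolutelyContinuousOnInterval {X Y : Type*}
    [PseudoMetricSpace X] [PseudoMetricSpace Y] {K : NNReal} {g : X → Y} {f : ℝ → X} {a b : ℝ}
    (hg : LipschitzWith K g) (hf : AbsolutelyContinuousOnInterval f a b) :
    AbsolutelyContinuousOnInterval (fun t => g (f t)) a b := by
  refine squeeze_zero (fun t => Finset.sum_nonneg fun i _ => dist_nonneg) (fun t => ?_)
    (by simpa using Tendsto.const_mul (K : ℝ) hf)
  rw [Finset.mul_sum]
  exact Finset.sum_le_sum fun i _ => hg.dist_le_mul _ _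

variable {H : Type*} [NormedAddCommGroup H] [InnerProductSpace ℝ H]

theorem absolutelyContinuousOnInterval_norm_sq {H : Type*} [NormedAddCommGroup H] {f : ℝ → H}
    {a b : ℝ}
    (hf : AbsolutelyContinuousOnInterval f a b) :
    AbsolutelyContinuousOnInterval (fun t => ‖f t‖ ^ 2) a b := by
  have := LipschitzWith.comp_absolutelyContinuousOnInterval (lipschitzWith_one_norm (E := H)) hf
  simpa only [pow_two] using this.fun_mul this

/-- `ζ` is an arc over the path `⋃_{i = j}^{m} [τ i, τ (i+1)] × {i}` which, up to an input of norm at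
most `M`, moves with velocity `-F ζ` along flows and by the increment `-F ζ` at jumps, where `F` is
a positive operator, bounded by `c` along flows and by `1` at jumps. One field `F` serves for both
flows and jumps, because `F (τ (i+1)) i` is irrelevant to the flow. -/
structure DampedPath (F : ℝ → ℕ → H →L[ℝ] H) (ζ : ℝ → ℕ → H) (c M : ℝ) (j m : ℕ) (τ : ℕ → ℝ) :
    Prop where
  le : j ≤ m
  mono : ∀ i ∈ Finset.Icc j m, τ i ≤ τ (i + 1)
  arc : ∀ i ∈ Finset.Icc j m, AbsolutelyContinuousOnInterval (fun t => ζ t i) (τ i) (τ (i + 1))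
  flow : ∀ i ∈ Finset.Icc j m, ∀ᵐ t : ℝ, t ∈ Ioo (τ i) (τ (i + 1)) →
    ∃ u, ‖u‖ ≤ M ∧ HasDerivAt (fun s => ζ s i) (-F t i (ζ t i) + u) t
  jump : ∀ i ∈ Finset.Ico j m, ∃ u, ‖u‖ ≤ M ∧
    ζ (τ (i + 1)) (i + 1) = ζ (τ (i + 1)) i - F (τ (i + 1)) i (ζ (τ (i + 1)) i) + u
  flow_pos : ∀ i ∈ Finset.Icc j m, ∀ t ∈ Ioo (τ i) (τ (i + 1)), (F t i).IsPositive ∧ ‖F t i‖ ≤ c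
  jump_pos : ∀ i ∈ Finset.Ico j m, (F (τ (i + 1)) i).IsPositive ∧ ‖F (τ (i + 1)) i‖ ≤ 1
  meas : ∀ i ∈ Finset.Icc j m,
    AEStronglyMeasurable (fun t => F t i) (volume.restrict (Ioc (τ i) (τ (i + 1))))

/-- The density of the energy dissipated by a damped path. -/
def dissipation (F : ℝ → ℕ → H →L[ℝ] H) (ζ : ℝ → ℕ → H) (t : ℝ) (i : ℕ) : ℝ :=
  ⟪ζ t i, F t i (ζ t i)⟫

variable {F : ℝ → ℕ → H →L[ℝ] H} {ζ : ℝ → ℕ → H} {c M L : ℝ} {j m : ℕ} {τ : ℕ → ℝ}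

namespace DampedPath

theorem truncate (h : DampedPath F ζ c M j m τ) {k : ℕ} {s : ℝ} (hk : k ∈ Finset.Icc j m)
    (hs : s ∈ Icc (τ k) (τ (k + 1))) :
    DampedPath F ζ c M j k (Function.update τ (k + 1) s) := by
  obtain ⟨hjk, hkm⟩ := Finset.mem_Icc.1 hk
  have hlow : ∀ i ∈ Finset.Icc j k, Function.update τ (k + 1) s i = τ i := fun i hi =>
    Function.update_of_ne (by have := (Finset.mem_Icc.1 hi).2; lia) _ _
  have hup : ∀ i ∈ Finset.Ico j k, Function.update τ (k + 1) s (i + 1) = τ (i + 1) := fun i hi =>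
    Function.update_of_ne (by have := (Finset.mem_Ico.1 hi).2; lia) _ _
  have hmem : ∀ i ∈ Finset.Icc j k, i ∈ Finset.Icc j m := fun i hi =>
    Finset.Icc_subset_Icc_right hkm hi
  have hmem' : ∀ i ∈ Finset.Ico j k, i ∈ Finset.Ico j m := fun i hi =>
    Finset.Ico_subset_Ico_right hkm hi
  have hle : ∀ i ∈ Finset.Icc j k, τ i ≤ Function.update τ (k + 1) s (i + 1) ∧
      Function.update τ (k + 1) s (i + 1) ≤ τ (i + 1) := fun i hi => by
    obtain rfl | hne := eq_or_ne i k
    · rw [Function.update_self]; exact hs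
    · rw [Function.update_of_ne (by lia)]; exact ⟨h.mono i (hmem i hi), le_rfl⟩
  refine ⟨hjk, ?_, ?_, ?_, ?_, ?_, ?_, ?_⟩
  · intro i hi; rw [hlow i hi]; exact (hle i hi).1
  · intro i hi
    rw [hlow i hi]
    refine (h.arc i (hmem i hi)).mono ?_
    rw [uIcc_of_le (hle i hi).1, uIcc_of_le (h.mono i (hmem i hi))]
    exact Icc_subset_Icc_right (hle i hi).2
  · intro i hi
    filter_upwards [h.flow i (hmem i hi)] with t ht htm
    rw [hlow i hi] at htm
    exact ht ⟨htm.1, htm.2.trans_le (hle i hi).2⟩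
  · intro i hi; rw [hup i hi]; exact h.jump i (hmem' i hi)
  · intro i hi t ht
    rw [hlow i hi] at ht
    exact h.flow_pos i (hmem i hi) t ⟨ht.1, ht.2.trans_le (hle i hi).2⟩
  · intro i hi; rw [hup i hi]; exact h.jump_pos i (hmem' i hi)
  · intro i hi
    rw [hlow i hi]
    exact (h.meas i (hmem i hi)).mono_set (Ioc_subset_Ioc_right (hle i hi).2)

theorem length_truncate_le (h : DampedPath F ζ c M j m τ) {i : ℕ} {t : ℝ}
    (hi : i ∈ Finset.Icc j m) (ht : t ∈ Icc (τ i) (τ (i + 1)))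
    (hL : τ (m + 1) - τ j + ((m : ℝ) - j) ≤ L) :
    Function.update τ (i + 1) t j = τ j ∧ t - τ j + ((i : ℝ) - j) ≤ L := by
  obtain ⟨hji, him⟩ := Finset.mem_Icc.1 hi
  refine ⟨Function.update_of_ne (by lia) _ _, ?_⟩
  have h1 : τ (i + 1) ≤ τ (m + 1) :=
    monotoneOn_of_steps h.mono ⟨by lia, by lia⟩ ⟨by lia, le_rfl⟩ (by lia)
  have h2 : (i : ℝ) ≤ m := by exact_mod_cast him
  linarith [ht.2]

theorem integrable_inner (h : DampedPath F ζ c M j m τ) {x : ℝ → ℕ → H}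
    (hx : ∀ i ∈ Finset.Icc j m, ContinuousOn (fun t => x t i) (Icc (τ i) (τ (i + 1)))) :
    HybridIntegrable (fun t i => ⟪x t i, F t i (x t i)⟫) j m τ := by
  intro i hi
  have hle := h.mono i hi
  obtain ⟨C, hC⟩ := isCompact_Icc.exists_bound_of_continuousOn (hx i hi)
  have hxm : AEStronglyMeasurable (fun t => x t i) (volume.restrict (Ioc (τ i) (τ (i + 1)))) :=
    ((hx i hi).mono Ioc_subset_Icc_self).aestronglyMeasurable measurableSet_Ioc
  rw [intervalIntegrable_iff_integrableOn_Ioc_of_le hle]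
  refine Integrable.of_bound (C := c * C ^ 2) (hxm.inner
    ((ContinuousLinearMap.id ℝ (H →L[ℝ] H)).aestronglyMeasurable_comp₂ (h.meas i hi) hxm)) ?_
  rw [← Measure.restrict_congr_set Ioo_ae_eq_Ioc]
  refine (ae_restrict_iff' measurableSet_Ioo).2 (.of_forall fun t ht => ?_)
  obtain ⟨hpos, hc⟩ := h.flow_pos i hi t ht
  rw [Real.norm_of_nonneg (inner_apply_nonneg hpos _)]
  have hc0 : 0 ≤ c := (norm_nonneg _).trans hc
  refine (inner_apply_le hc _).trans ?_
  gcongr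
  exact hC t (Ioo_subset_Icc_self ht)

theorem integrable_dissipation (h : DampedPath F ζ c M j m τ) :
    HybridIntegrable (dissipation F ζ) j m τ :=
  h.integrable_inner fun i hi => by
    have := (h.arc i hi).continuousOn
    rwa [uIcc_of_le (h.mono i hi)] at this

theorem dissipation_flow_nonneg (h : DampedPath F ζ c M j m τ) :
    ∀ i ∈ Finset.Icc j m, ∀ t ∈ Ioo (τ i) (τ (i + 1)), 0 ≤ dissipation F ζ t i :=
  fun i hi t ht => inner_apply_nonneg (h.flow_pos i hi t ht).1 _

theorem dissipation_jump_nonneg (h : DampedPath F ζ c M j m τ) :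
    ∀ i ∈ Finset.Ico j m, 0 ≤ dissipation F ζ (τ (i + 1)) i :=
  fun i hi => inner_apply_nonneg (h.jump_pos i hi).1 _

theorem hybridIntegral_dissipation_nonneg (h : DampedPath F ζ c M j m τ) :
    0 ≤ hybridIntegral (dissipation F ζ) j m τ := by
  have := hybridIntegral_mono h.mono (hybridIntegrable_const 0) h.integrable_dissipation
    h.dissipation_flow_nonneg h.dissipation_jump_nonneg
  rw [hybridIntegral_const h.le] at this
  simpa using this

theorem jump_norm_sq_le (h : DampedPath F ζ c M j m τ) (hM : 0 ≤ M) {i : ℕ}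
    (hi : i ∈ Finset.Ico j m) :
    ‖ζ (τ (i + 1)) (i + 1)‖ ^ 2 ≤ ‖ζ (τ (i + 1)) i‖ ^ 2 - dissipation F ζ (τ (i + 1)) i +
      2 * ‖ζ (τ (i + 1)) i‖ * M + M ^ 2 := by
  obtain ⟨u, hu, he⟩ := h.jump i hi
  obtain ⟨hpos, h1⟩ := h.jump_pos i hi
  rw [he]
  set x := ζ (τ (i + 1)) i
  set T := F (τ (i + 1)) i
  have h2 : ‖x - T x‖ ^ 2 ≤ ‖x‖ ^ 2 - ⟪x, T x⟫ := norm_sub_apply_sq_le hpos h1 x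
  have h3 : ‖x - T x‖ ≤ ‖x‖ :=
    abs_le_of_sq_le_sq' (h2.trans (sub_le_self _ (inner_apply_nonneg hpos x))) (norm_nonneg x) |>.2
  have h4 : ‖x - T x + u‖ ≤ ‖x - T x‖ + M := (norm_add_le _ _).trans (by gcongr)
  have h5 : ‖x - T x + u‖ ^ 2 ≤ (‖x - T x‖ + M) ^ 2 := by gcongr
  have h6 : ‖x - T x‖ * M ≤ ‖x‖ * M := by gcongr
  change _ ≤ ‖x‖ ^ 2 - ⟪x, T x⟫ + 2 * ‖x‖ * M + M ^ 2
  nlinarith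

theorem flow_norm_sq_deriv (h : DampedPath F ζ c M j m τ) {i : ℕ} (hi : i ∈ Finset.Icc j m) :
    ∀ᵐ t : ℝ, t ∈ Ioo (τ i) (τ (i + 1)) →
      ∃ d, HasDerivAt (fun s => ‖ζ s i‖ ^ 2) d t ∧
        d ≤ -2 * dissipation F ζ t i + 2 * ‖ζ t i‖ * M := by
  filter_upwards [h.flow i hi] with t ht hmem
  obtain ⟨u, hu, hd⟩ := ht hmem
  refine ⟨_, hd.norm_sq, ?_⟩
  have h1 := (real_inner_le_norm (ζ t i) u).trans
    (mul_le_mul_of_nonneg_left hu (norm_nonneg _))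
  rw [inner_add_right, inner_neg_right]
  unfold dissipation
  linarith

/-- Growth estimate: the weighted energy `exp (-(t + i)) (|ζ|² + 2 M²)` does not increase.
The multiple `2 M²` makes the bracket at most double at a jump, while the weight shrinks by
`exp 1 > 2`. -/
theorem norm_sq_end_le (h : DampedPath F ζ c M j m τ) (hM : 0 ≤ M)
    (hL : τ (m + 1) - τ j + ((m : ℝ) - j) ≤ L) :
    ‖ζ (τ (m + 1)) m‖ ^ 2 ≤ Real.exp L * (‖ζ (τ j) j‖ ^ 2 + 2 * M ^ 2) := by
  have key := sub_le_hybridIntegral (φ := fun _ _ => 0)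
    (f := fun t i => Real.exp (-(t + i)) * (‖ζ t i‖ ^ 2 + 2 * M ^ 2)) h.le h.mono ?_
    (hybridIntegrable_const 0) ?_ ?_
  · rw [hybridIntegral_const h.le, mul_zero, sub_nonpos] at key
    have h1 : Real.exp (τ (m + 1) + m) * Real.exp (-(τ (m + 1) + m)) = 1 := by
      rw [← Real.exp_add]; simp
    have h2 : Real.exp (τ (m + 1) + m) * Real.exp (-(τ j + j)) ≤ Real.exp L := by
      rw [← Real.exp_add]; exact Real.exp_le_exp.2 (by linarith)
    have h3 := mul_le_mul_of_nonneg_left key (Real.exp_pos (τ (m + 1) + m)).le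
    rw [← mul_assoc, h1, one_mul, ← mul_assoc] at h3
    have h4 : 0 ≤ ‖ζ (τ j) j‖ ^ 2 + 2 * M ^ 2 := by positivity
    nlinarith [mul_le_mul_of_nonneg_right h2 h4, sq_nonneg M]
  · intro i hi
    refine AbsolutelyContinuousOnInterval.fun_mul ?_ ?_
    · exact (by fun_prop : ContDiff ℝ 1 fun t : ℝ => Real.exp (-(t + i))).contDiffOn
        |>.absolutelyContinuousOnInterval
    · exact (absolutelyContinuousOnInterval_norm_sq (h.arc i hi)).fun_add
        contDiffOn_const.absolutelyContinuousOnInterval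
  · intro i hi
    filter_upwards [h.flow_norm_sq_deriv hi] with t ht hmem
    obtain ⟨d, hd, hle⟩ := ht hmem
    have he : HasDerivAt (fun s : ℝ => Real.exp (-(s + i))) (Real.exp (-(t + i)) * -1) t :=
      ((hasDerivAt_id t).add_const (i : ℝ)).neg.exp
    refine ⟨_, he.mul (hd.add_const _), ?_⟩
    have h1 := h.dissipation_flow_nonneg i hi t hmem
    have h2 : d ≤ ‖ζ t i‖ ^ 2 + 2 * M ^ 2 := by nlinarith [sq_nonneg (‖ζ t i‖ - M), sq_nonneg M]
    nlinarith [Real.exp_pos (-(t + i))]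
  · intro i hi
    have h1 := h.jump_norm_sq_le hM hi
    have h2 := h.dissipation_jump_nonneg i hi
    set x := ‖ζ (τ (i + 1)) i‖
    set y := ‖ζ (τ (i + 1)) (i + 1)‖
    have h3 : y ^ 2 + 2 * M ^ 2 ≤ 2 * (x ^ 2 + 2 * M ^ 2) := by nlinarith [sq_nonneg (x - M)]
    have h4 : Real.exp (-(τ (i + 1) + ((i + 1 : ℕ) : ℝ))) * 2 ≤ Real.exp (-(τ (i + 1) + i)) := by
      have : Real.exp (-(τ (i + 1) + i)) =
          Real.exp (-(τ (i + 1) + ((i + 1 : ℕ) : ℝ))) * Real.exp 1 := by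
        rw [← Real.exp_add]; push_cast; ring_nf
      rw [this]
      gcongr
      linarith [Real.add_one_le_exp 1]
    have h5 : 0 ≤ x ^ 2 + 2 * M ^ 2 := by positivity
    have h6 := mul_le_mul_of_nonneg_left h3
      (Real.exp_pos (-(τ (i + 1) + ((i + 1 : ℕ) : ℝ)))).le
    have h7 := mul_le_mul_of_nonneg_right h4 h5
    linarith

/-- Displacement estimate: an arc that dissipates little energy stays close to its origin. -/
theorem norm_sub_sq_end_le (h : DampedPath F ζ c M j m τ) (hc : 1 ≤ c) (hL0 : 0 < L)
    (hL : τ (m + 1) - τ j + ((m : ℝ) - j) ≤ L) :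
    ‖ζ (τ (m + 1)) m - ζ (τ j) j‖ ^ 2 ≤
      2 * L * c * hybridIntegral (dissipation F ζ) j m τ + 2 * L ^ 2 * M ^ 2 := by
  set v := ζ (τ (m + 1)) m - ζ (τ j) j with hv
  have hc0 : 0 < c := by linarith
  -- Young's inequality for the velocity `-T x + u`, tested against `v`
  have young : ∀ (T : H →L[ℝ] H) (x u : H), T.IsPositive → ‖T‖ ≤ c → ‖u‖ ≤ M →
      ⟪v, -T x + u⟫ ≤ L * c * ⟪x, T x⟫ + (‖v‖ ^ 2 / (2 * L) + L * M ^ 2) := by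
    intro T x u hT hTc hu
    have h1 := norm_apply_sq_le hT hc0 hTc x
    have h2 : ⟪v, -T x + u⟫ ≤ ‖v‖ * ‖T x‖ + ‖v‖ * M := by
      rw [inner_add_right]
      refine add_le_add ((real_inner_le_norm _ _).trans (by rw [norm_neg])) ?_
      exact (real_inner_le_norm _ _).trans (by gcongr)
    have h3 : ∀ a : ℝ, ‖v‖ * a ≤ ‖v‖ ^ 2 / (4 * L) + L * a ^ 2 := fun a => by
      have : ‖v‖ ^ 2 / (4 * L) + L * a ^ 2 - ‖v‖ * a = (‖v‖ - 2 * L * a) ^ 2 / (4 * L) := by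
        field_simp; ring
      have : 0 ≤ (‖v‖ - 2 * L * a) ^ 2 / (4 * L) := by positivity
      linarith
    have h4 : ‖v‖ ^ 2 / (2 * L) = ‖v‖ ^ 2 / (4 * L) + ‖v‖ ^ 2 / (4 * L) := by field_simp; ring
    nlinarith [h3 ‖T x‖, h3 M]
  have key := sub_le_hybridIntegral (f := fun t i => ⟪v, ζ t i⟫)
    (φ := fun t i => L * c * dissipation F ζ t i + (‖v‖ ^ 2 / (2 * L) + L * M ^ 2)) h.le h.mono ?_
    ((h.integrable_dissipation.const_mul _).add (hybridIntegrable_const _)) ?_ ?_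
  · rw [← inner_sub_right, ← hv, real_inner_self_eq_norm_sq,
      hybridIntegral_add (h.integrable_dissipation.const_mul _) (hybridIntegrable_const _),
      hybridIntegral_const_mul, hybridIntegral_const h.le] at key
    have h1 : (τ (m + 1) - τ j + ((m : ℝ) - j)) * (‖v‖ ^ 2 / (2 * L) + L * M ^ 2) ≤
        L * (‖v‖ ^ 2 / (2 * L) + L * M ^ 2) := by gcongr
    have h2 : L * (‖v‖ ^ 2 / (2 * L) + L * M ^ 2) = ‖v‖ ^ 2 / 2 + L ^ 2 * M ^ 2 := by
      field_simp
    linarith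
  · intro i hi
    exact LipschitzWith.comp_absolutelyContinuousOnInterval (innerSL ℝ v).lipschitz (h.arc i hi)
  · intro i hi
    filter_upwards [h.flow i hi] with t ht hmem
    obtain ⟨u, hu, hd⟩ := ht hmem
    obtain ⟨hT, hTc⟩ := h.flow_pos i hi t hmem
    exact ⟨_, (innerSL ℝ v).hasFDerivAt.comp_hasDerivAt t hd, young _ _ _ hT hTc hu⟩
  · intro i hi
    obtain ⟨u, hu, he⟩ := h.jump i hi
    obtain ⟨hT, hTc⟩ := h.jump_pos i hi
    have := young _ (ζ (τ (i + 1)) i) u hT (hTc.trans hc) hu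
    rw [← inner_sub_right, he]
    convert! this using 2
    abel

/-- Energy balance: the energy lost over the path is at least the dissipated energy, up to the
contribution of the input; `G` is any bound of the energy and `η` the weight in Young's
inequality. -/
theorem norm_sq_end_le_sub_dissipation (h : DampedPath F ζ c M j m τ) (hM : 0 ≤ M)
    (hL : τ (m + 1) - τ j + ((m : ℝ) - j) ≤ L) {η G : ℝ} (hη : 0 < η)
    (hG0 : 0 ≤ G)
    (hG : ∀ i ∈ Finset.Icc j m, ∀ t ∈ Icc (τ i) (τ (i + 1)), ‖ζ t i‖ ^ 2 ≤ G) :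
    ‖ζ (τ (m + 1)) m‖ ^ 2 ≤ ‖ζ (τ j) j‖ ^ 2 - hybridIntegral (dissipation F ζ) j m τ +
      L * (η * G + M ^ 2 / η + M ^ 2) := by
  have young : ∀ i ∈ Finset.Icc j m, ∀ t ∈ Icc (τ i) (τ (i + 1)),
      2 * ‖ζ t i‖ * M ≤ η * G + M ^ 2 / η := fun i hi t ht => by
    have h1 : η * ‖ζ t i‖ ^ 2 + M ^ 2 / η - 2 * ‖ζ t i‖ * M = (η * ‖ζ t i‖ - M) ^ 2 / η := by
      field_simp; ring
    have h2 : 0 ≤ (η * ‖ζ t i‖ - M) ^ 2 / η := by positivity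
    nlinarith [mul_le_mul_of_nonneg_left (hG i hi t ht) hη.le]
  have key := sub_le_hybridIntegral (f := fun t i => ‖ζ t i‖ ^ 2)
    (φ := fun t i => -1 * dissipation F ζ t i + (η * G + M ^ 2 / η + M ^ 2)) h.le h.mono
    (fun i hi => absolutelyContinuousOnInterval_norm_sq (h.arc i hi))
    ((h.integrable_dissipation.const_mul _).add (hybridIntegrable_const _)) ?_ ?_
  · rw [hybridIntegral_add (h.integrable_dissipation.const_mul _) (hybridIntegrable_const _),
      hybridIntegral_const_mul, hybridIntegral_const h.le] at key
    have : (τ (m + 1) - τ j + ((m : ℝ) - j)) * (η * G + M ^ 2 / η + M ^ 2) ≤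
        L * (η * G + M ^ 2 / η + M ^ 2) := by gcongr
    linarith
  · intro i hi
    filter_upwards [h.flow_norm_sq_deriv hi] with t ht hmem
    obtain ⟨d, hd, hle⟩ := ht hmem
    refine ⟨d, hd, ?_⟩
    have h1 := h.dissipation_flow_nonneg i hi t hmem
    have h2 := young i hi t (Ioo_subset_Icc_self hmem)
    nlinarith [sq_nonneg M]
  · intro i hi
    have h1 := h.jump_norm_sq_le hM hi
    have hi' := Finset.Ico_subset_Icc_self hi
    have h2 := young i hi' (τ (i + 1)) ⟨h.mono i hi', le_rfl⟩
    linarith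

/-- The excitation of the initial value along the path is controlled by the dissipated energy. -/
theorem hybridIntegral_inner_start_le (h : DampedPath F ζ c M j m τ) (hc : 1 ≤ c) (hL0 : 0 < L)
    (hL : τ (m + 1) - τ j + ((m : ℝ) - j) ≤ L) :
    hybridIntegral (fun t i => ⟪ζ (τ j) j, F t i (ζ (τ j) j)⟫) j m τ ≤
      2 * hybridIntegral (dissipation F ζ) j m τ +
        L * (2 * c * (2 * L * c * hybridIntegral (dissipation F ζ) j m τ + 2 * L ^ 2 * M ^ 2)) := by
  set δ := hybridIntegral (dissipation F ζ) j m τ with hδ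
  set z := ζ (τ j) j with hz
  have hδ0 : 0 ≤ δ := h.hybridIntegral_dissipation_nonneg
  -- the displacement estimate at every intermediate point of the path
  have hdist : ∀ i ∈ Finset.Icc j m, ∀ t ∈ Icc (τ i) (τ (i + 1)),
      ‖ζ t i - z‖ ^ 2 ≤ 2 * L * c * δ + 2 * L ^ 2 * M ^ 2 := by
    intro i hi t ht
    have htr := h.truncate hi ht
    obtain ⟨hstart, hlen⟩ := h.length_truncate_le hi ht hL
    have h3 := htr.norm_sub_sq_end_le (L := L) hc hL0 (by rwa [Function.update_self, hstart])
    rw [Function.update_self, hstart] at h3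
    refine h3.trans ?_
    gcongr
    exact hybridIntegral_update_le h.mono h.integrable_dissipation h.dissipation_flow_nonneg
      h.dissipation_jump_nonneg hi ht
  set R := 2 * L * c * δ + 2 * L ^ 2 * M ^ 2 with hR
  have hc0 : 0 < c := by linarith
  have hR0 : 0 ≤ R := by positivity
  have hpt : ∀ i ∈ Finset.Icc j m, ∀ t ∈ Icc (τ i) (τ (i + 1)), (F t i).IsPositive → ‖F t i‖ ≤ c →
      ⟪z, F t i z⟫ ≤ 2 * dissipation F ζ t i + 2 * c * R := by
    intro i hi t ht hpos hFc
    have h1 := inner_apply_le_two_mul_add hpos z (ζ t i)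
    have h2 := inner_apply_le hFc (ζ t i - z)
    have h3 := mul_le_mul_of_nonneg_left (hdist i hi t ht) hc0.le
    unfold dissipation
    linarith
  have key := hybridIntegral_mono h.mono (h.integrable_inner (x := fun _ _ => z)
    fun _ _ => continuousOn_const)
    ((h.integrable_dissipation.const_mul 2).add (hybridIntegrable_const (2 * c * R)))
    (fun i hi t ht => hpt i hi t (Ioo_subset_Icc_self ht) (h.flow_pos i hi t ht).1
      (h.flow_pos i hi t ht).2)
    (fun i hi => hpt i (Finset.Ico_subset_Icc_self hi) _
      ⟨h.mono i (Finset.Ico_subset_Icc_self hi), le_rfl⟩ (h.jump_pos i hi).1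
      ((h.jump_pos i hi).2.trans hc))
  rw [hybridIntegral_add (h.integrable_dissipation.const_mul _) (hybridIntegrable_const _),
    hybridIntegral_const_mul, hybridIntegral_const h.le] at key
  refine key.trans ?_
  gcongr

/-- Contraction over an exciting path: the factor `ρ` and the gain `C` depend only on the bound `c`
of the damping, the bound `L` of the length of the path and the level `μ` of excitation. -/
theorem exists_contraction (H : Type*) [NormedAddCommGroup H] [InnerProductSpace ℝ H]
    {c L μ : ℝ} (hc : 1 ≤ c) (hL0 : 0 < L) (hμ : 0 < μ) :
    ∃ ρ C : ℝ, 0 < ρ ∧ ρ < 1 ∧ 0 ≤ C ∧ ∀ (F : ℝ → ℕ → H →L[ℝ] H) (ζ : ℝ → ℕ → H) (M : ℝ) (j m : ℕ)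
      (τ : ℕ → ℝ), DampedPath F ζ c M j m τ → 0 ≤ M → τ (m + 1) - τ j + ((m : ℝ) - j) ≤ L →
      μ * ‖ζ (τ j) j‖ ^ 2 ≤ hybridIntegral (fun t i => ⟪ζ (τ j) j, F t i (ζ (τ j) j)⟫) j m τ →
      ‖ζ (τ (m + 1)) m‖ ^ 2 ≤ ρ * ‖ζ (τ j) j‖ ^ 2 + C * M ^ 2 := by
  have hc0 : 0 < c := by linarith
  -- without input, at least the fraction `a` of the energy is dissipated; the cap `1` keeps the
  -- contraction factor `1 - a / 2` positive
  set b : ℝ := 2 + 4 * c ^ 2 * L ^ 2 with hb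
  have hb0 : 0 < b := by positivity
  set a : ℝ := min (μ / b) 1 with ha
  have ha0 : 0 < a := lt_min (by positivity) one_pos
  have ha1 : a ≤ 1 := min_le_right _ _
  -- with this weight, the input terms cost at most half of the fraction `a`
  set η : ℝ := a / (2 * L * Real.exp L) with hη
  have hE := Real.exp_pos L
  have hη0 : 0 < η := by positivity
  refine ⟨1 - a / 2, 4 * c * L ^ 3 / b + L * (η * (Real.exp L * 2) + 1 / η + 1), by linarith,
    by linarith, by positivity, ?_⟩
  intro F ζ M j m τ h hM hL hPE
  set δ := hybridIntegral (dissipation F ζ) j m τ with hδ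
  set V := ‖ζ (τ j) j‖ ^ 2 with hV
  have hV0 : 0 ≤ V := by positivity
  have h1 := hPE.trans (h.hybridIntegral_inner_start_le hc hL0 hL)
  have h2 : a * V ≤ δ + 4 * c * L ^ 3 / b * M ^ 2 := by
    have h3 : μ / b * V ≤ δ + 4 * c * L ^ 3 / b * M ^ 2 := by
      have : δ + 4 * c * L ^ 3 / b * M ^ 2 - μ / b * V =
          (b * δ + 4 * c * L ^ 3 * M ^ 2 - μ * V) / b := by field_simp
      have h4 : 0 ≤ (b * δ + 4 * c * L ^ 3 * M ^ 2 - μ * V) / b :=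
        div_nonneg (by rw [hb]; linarith) hb0.le
      linarith
    exact (mul_le_mul_of_nonneg_right (min_le_left _ _) hV0).trans h3
  have hG : ∀ i ∈ Finset.Icc j m, ∀ t ∈ Icc (τ i) (τ (i + 1)),
      ‖ζ t i‖ ^ 2 ≤ Real.exp L * (V + 2 * M ^ 2) := by
    intro i hi t ht
    obtain ⟨hstart, hlen⟩ := h.length_truncate_le hi ht hL
    have h3 := (h.truncate hi ht).norm_sq_end_le (L := L) hM
      (by rwa [Function.update_self, hstart])
    rwa [Function.update_self, hstart] at h3
  have h5 := h.norm_sq_end_le_sub_dissipation hM hL hη0 (by positivity) hG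
  have h6 : L * (η * (Real.exp L * (V + 2 * M ^ 2)) + M ^ 2 / η + M ^ 2) =
      a / 2 * V + L * (η * (Real.exp L * 2) + 1 / η + 1) * M ^ 2 := by
    have : L * η * Real.exp L = a / 2 := by rw [hη]; field_simp
    have e : L * (η * (Real.exp L * (V + 2 * M ^ 2)) + M ^ 2 / η + M ^ 2) =
      (L * η * Real.exp L) * V + L * (η * (Real.exp L * 2) + 1 / η + 1) * M ^ 2 := by ring
    rw [e, this]
  rw [h6] at h5
  linarith

end DampedPath

end DampedPath

/-! ### Hybrid time domains and windows -/

section Domain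

/-- A chain `D` contains no point of level `i` later than a jump from level `i`, so `Φ_{AB}` takes
the value `B` at jumps. -/
theorem notMem_interior_flowInterval_of_jump {D : Set (ℝ × ℕ)}
    (hchain : ∀ p ∈ D, ∀ q ∈ D, p ≤ q ∨ q ≤ p) {t : ℝ} {i : ℕ} (h : (t, i + 1) ∈ D) :
    t ∉ interior (flowInterval D i) := by
  intro ht
  obtain ⟨ε, hε, hball⟩ := Metric.isOpen_iff.1 isOpen_interior t ht
  have hball' : t + ε / 2 ∈ Metric.ball t ε := by
    rw [Metric.mem_ball, Real.dist_eq, add_sub_cancel_left, abs_of_pos (by linarith)]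
    linarith
  have hmem : t + ε / 2 ∈ flowInterval D i := interior_subset (hball hball')
  rcases hchain _ hmem _ h with hle | hle
  · have := (Prod.mk_le_mk.1 hle).1
    linarith
  · have := (Prod.mk_le_mk.1 hle).2
    lia

/-- Inside a chain `D`, a hybrid time domain `E ⊆ D` has no gaps: it contains every point of `D`
between its start and any of its points. -/
theorem IsHybridTimeDomainFrom.mem_of_le {D E : Set (ℝ × ℕ)} {t₀ : ℝ} {j₀ : ℕ}
    (hE : IsHybridTimeDomainFrom t₀ j₀ E) (hED : E ⊆ D)
    (hchain : ∀ p ∈ D, ∀ q ∈ D, p ≤ q ∨ q ≤ p) {s T : ℝ} {k J : ℕ} (hT : (T, J) ∈ E)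
    (hs : (s, k) ∈ D) (h0 : (t₀, j₀) ≤ (s, k)) (h1 : (s, k) ≤ (T, J)) : (s, k) ∈ E := by
  obtain ⟨τ, hstart, hend, hmono, hunion⟩ := hE.truncation T J hT
  rw [Prod.mk_le_mk] at h0 h1
  have hpiece : ∀ i ∈ Finset.Icc j₀ J, ∀ r ∈ Icc (τ i) (τ (i + 1)), (r, i) ∈ E := by
    intro i hi r hr
    have : (r, i) ∈ E ∩ Icc (t₀, j₀) (T, J) := by
      rw [hunion]
      exact mem_biUnion hi ⟨hr, rfl⟩
    exact this.1
  have hk : k ∈ Finset.Icc j₀ J := Finset.mem_Icc.2 ⟨h0.2, h1.2⟩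
  refine hpiece k hk s ⟨?_, ?_⟩
  · by_contra! hlt
    have hjk : j₀ ≠ k := by rintro rfl; linarith
    have hk' : k - 1 ∈ Finset.Icc j₀ J := Finset.mem_Icc.2 ⟨by lia, by lia⟩
    have hkk : k - 1 + 1 = k := by lia
    have hm := hpiece (k - 1) hk' (τ (k - 1 + 1)) ⟨hmono _ hk', le_rfl⟩
    rw [hkk] at hm
    rcases hchain _ hs _ (hED hm) with hle | hle
    · have := (Prod.mk_le_mk.1 hle).2; lia
    · have := (Prod.mk_le_mk.1 hle).1; linarith
  · by_contra! hlt
    have hkJ : k ≠ J := by rintro rfl; linarith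
    have hk' : k + 1 ∈ Finset.Icc j₀ J := Finset.mem_Icc.2 ⟨by lia, by lia⟩
    have hm := hpiece (k + 1) hk' (τ (k + 1)) ⟨le_rfl, hmono _ hk'⟩
    rcases hchain _ hs _ (hED hm) with hle | hle
    · have := (Prod.mk_le_mk.1 hle).1; linarith
    · have := (Prod.mk_le_mk.1 hle).2; lia

namespace IsShortestWindow

variable {D : Set (ℝ × ℕ)} {t K : ℝ} {j m : ℕ} {τ : ℕ → ℝ}

theorem piece_mem (h : IsShortestWindow D t j K m τ) {i : ℕ} (hi : i ∈ Finset.Icc j m) {s : ℝ}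
    (hs : s ∈ Icc (τ i) (τ (i + 1))) :
    (s, i) ∈ D ∧ (t, j) ≤ (s, i) ∧ (s, i) ≤ (τ (m + 1), m) := by
  have : (s, i) ∈ D ∩ Icc (t, j) (τ (m + 1), m) := by
    rw [h.eq_union]
    exact mem_biUnion hi ⟨hs, rfl⟩
  exact ⟨this.1, this.2.1, this.2.2⟩

theorem mem_piece (h : IsShortestWindow D t j K m τ) {s : ℝ} {i : ℕ} (hD : (s, i) ∈ D)
    (h0 : (t, j) ≤ (s, i)) (h1 : (s, i) ≤ (τ (m + 1), m)) :
    i ∈ Finset.Icc j m ∧ s ∈ Icc (τ i) (τ (i + 1)) := by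
  have hmem : (s, i) ∈ D ∩ Icc (t, j) (τ (m + 1), m) := ⟨hD, h0, h1⟩
  rw [h.eq_union] at hmem
  simp only [mem_iUnion, mem_prod, mem_singleton_iff] at hmem
  obtain ⟨i', hi', hs, rfl⟩ := hmem
  exact ⟨hi', hs⟩

/-- A shortest window of length at least `K` has length at most `K + 1`: it overshoots `K` only if
it ends with a jump. -/
theorem length_le (h : IsShortestWindow D t j K m τ) (hK : 0 < K) :
    τ (m + 1) - τ j + ((m : ℝ) - j) ≤ K + 1 := by
  have hm : m ∈ Finset.Icc j m := Finset.mem_Icc.2 ⟨h.le, le_rfl⟩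
  have hlast := h.mono m hm
  rw [h.start_eq]
  by_cases hlen : K ≤ τ m - t + ((m : ℝ) - j)
  · obtain ⟨hD, h0, -⟩ := h.piece_mem hm ⟨le_rfl, hlast⟩
    have h1 : τ (m + 1) ≤ τ m := (Prod.mk_le_mk.1 (h.shortest _ _ hD h0 hlen)).1
    have hjm : j ≠ m := by
      rintro rfl
      rw [h.start_eq] at hlen
      linarith
    have hjm' := h.le
    by_contra! hlong
    have hm1 : m - 1 ∈ Finset.Icc j m := Finset.mem_Icc.2 ⟨by lia, by lia⟩
    obtain ⟨hD', h0', -⟩ := h.piece_mem hm1 ⟨h.mono _ hm1, le_rfl⟩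
    have hcast : ((m - 1 : ℕ) : ℝ) = m - 1 := by
      rw [Nat.cast_sub (by lia)]; simp
    have hmm : m - 1 + 1 = m := by lia
    rw [hmm] at hD' h0'
    have := (Prod.mk_le_mk.1 (h.shortest _ _ hD' h0' (by rw [hcast]; linarith))).2
    lia
  · -- the point of the last piece at distance exactly `K`
    push Not at hlen
    by_contra! hlong
    have hs : t + K - ((m : ℝ) - j) ∈ Icc (τ m) (τ (m + 1)) := ⟨by linarith, by linarith⟩
    obtain ⟨hD, h0, -⟩ := h.piece_mem hm hs
    have := (Prod.mk_le_mk.1 (h.shortest _ _ hD h0 (by linarith))).1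
    linarith

end IsShortestWindow

end Domain

/-! ### Solutions as damped paths -/

section Solution

variable {n : ℕ}

theorem continuous_toEuclideanCLM :
    Continuous (fun M : Matrix (Fin n) (Fin n) ℝ => Matrix.toEuclideanCLM (𝕜 := ℝ) M) :=
  (AddMonoidHomClass.isometry_of_norm (Matrix.toEuclideanCLM (𝕜 := ℝ) (n := Fin n))
    fun _ => rfl).continuous

/-- The quadratic form of a matrix at `z`, as a continuous linear functional of the matrix. -/
def quadraticFunctional (z : EuclideanSpace ℝ (Fin n)) : Matrix (Fin n) (Fin n) ℝ →L[ℝ] ℝ where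
  toFun M := ⟪z, Matrix.toEuclideanCLM (𝕜 := ℝ) M z⟫
  map_add' M N := by simp [inner_add_right]
  map_smul' a M := by simp [inner_smul_right]
  cont := continuous_const.inner (continuous_toEuclideanCLM.clm_apply continuous_const)

theorem _root_.ContinuousLinearMap.map_hybridIntegral {X : Type*} [NormedAddCommGroup X]
    [NormedSpace ℝ X] [CompleteSpace X] (ℓ : X →L[ℝ] ℝ) {φ : ℝ → ℕ → X} {j m : ℕ} {τ : ℕ → ℝ}
    (hφ : HybridIntegrable φ j m τ) :
    ℓ (hybridIntegral φ j m τ) = hybridIntegral (fun t i => ℓ (φ t i)) j m τ := by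
  unfold hybridIntegral
  rw [map_add, map_sum, map_sum]
  congr 1
  exact Finset.sum_congr rfl fun i hi => (ℓ.intervalIntegral_comp_comm (hφ i hi)).symm

theorem isPositive_toEuclideanCLM {M : Matrix (Fin n) (Fin n) ℝ} (hM : M.PosSemidef) :
    (Matrix.toEuclideanCLM (𝕜 := ℝ) M).IsPositive :=
  Matrix.isPositive_toEuclideanLin_iff.2 hM

theorem mul_norm_sq_le_of_posSemidef {N : Matrix (Fin n) (Fin n) ℝ} {μ : ℝ}
    (h : (N - μ • (1 : Matrix (Fin n) (Fin n) ℝ)).PosSemidef) (z : EuclideanSpace ℝ (Fin n)) :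
    μ * ‖z‖ ^ 2 ≤ quadraticFunctional z N := by
  have h1 : 0 ≤ quadraticFunctional z (N - μ • (1 : Matrix (Fin n) (Fin n) ℝ)) :=
    inner_apply_nonneg (isPositive_toEuclideanCLM h) z
  have h2 : quadraticFunctional z (1 : Matrix (Fin n) (Fin n) ℝ) = ‖z‖ ^ 2 := by
    change ⟪z, Matrix.toEuclideanCLM (𝕜 := ℝ) 1 z⟫ = _
    rw [map_one]
    exact real_inner_self_eq_norm_sq z
  rw [map_sub, map_smul, h2, smul_eq_mul] at h1
  linarith

variable {D : Set (ℝ × ℕ)} {A B : ℝ → ℕ → Matrix (Fin n) (Fin n) ℝ} {c : ℝ}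

/-- The pieces of the path `(j, m, τ)` lie in `E`. -/
structure IsPathIn (E : Set (ℝ × ℕ)) (j m : ℕ) (τ : ℕ → ℝ) : Prop where
  le : j ≤ m
  mono : ∀ i ∈ Finset.Icc j m, τ i ≤ τ (i + 1)
  mem : ∀ i ∈ Finset.Icc j m, ∀ s ∈ Icc (τ i) (τ (i + 1)), (s, i) ∈ E

namespace IsPathIn

variable {E : Set (ℝ × ℕ)} {j m : ℕ} {τ : ℕ → ℝ}

theorem Ioo_subset_interior (h : IsPathIn E j m τ) {i : ℕ} (hi : i ∈ Finset.Icc j m) :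
    Ioo (τ i) (τ (i + 1)) ⊆ interior (flowInterval E i) :=
  isOpen_Ioo.subset_interior_iff.2 fun s hs => h.mem i hi s (Ioo_subset_Icc_self hs)

theorem jump_mem (h : IsPathIn E j m τ) {i : ℕ} (hi : i ∈ Finset.Ico j m) :
    (τ (i + 1), i) ∈ E ∧ (τ (i + 1), i + 1) ∈ E := by
  have hi1 : i ∈ Finset.Icc j m := Finset.Ico_subset_Icc_self hi
  have hi2 : i + 1 ∈ Finset.Icc j m := by
    rw [Finset.mem_Ico] at hi
    exact Finset.mem_Icc.2 ⟨by lia, by lia⟩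
  exact ⟨h.mem i hi1 _ ⟨h.mono i hi1, le_rfl⟩, h.mem (i + 1) hi2 _ ⟨le_rfl, h.mono _ hi2⟩⟩

theorem PhiAB_flow (h : IsPathIn D j m τ) {i : ℕ} (hi : i ∈ Finset.Icc j m) {t : ℝ}
    (ht : t ∈ Ioo (τ i) (τ (i + 1))) : PhiAB D A B t i = A t i :=
  if_pos (h.Ioo_subset_interior hi ht)

theorem aestronglyMeasurable_PhiAB (h : IsPathIn D j m τ) (hA : FlowMeasurable D A) {i : ℕ}
    (hi : i ∈ Finset.Icc j m) :
    AEStronglyMeasurable (fun t => PhiAB D A B t i) (volume.restrict (Ioc (τ i) (τ (i + 1)))) := by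
  rw [← Measure.restrict_congr_set Ioo_ae_eq_Ioc]
  refine ((hA i).mono_set fun s hs => h.mem i hi s (Ioo_subset_Icc_self hs)).congr ?_
  exact (ae_restrict_iff' measurableSet_Ioo).2 (.of_forall fun t ht => (h.PhiAB_flow hi ht).symm)

theorem hybridIntegrable_PhiAB (h : IsPathIn D j m τ) (hA : FlowMeasurable D A)
    (hc : ∀ t i, (t, i) ∈ D → ‖A t i‖ ≤ c) : HybridIntegrable (PhiAB D A B) j m τ := by
  intro i hi
  rw [intervalIntegrable_iff_integrableOn_Ioc_of_le (h.mono i hi)]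
  refine Integrable.of_bound (C := c) (h.aestronglyMeasurable_PhiAB hA hi) ?_
  rw [← Measure.restrict_congr_set Ioo_ae_eq_Ioc]
  refine (ae_restrict_iff' measurableSet_Ioo).2 (.of_forall fun t ht => ?_)
  rw [h.PhiAB_flow hi ht]
  exact hc t i (h.mem i hi t (Ioo_subset_Icc_self ht))

end IsPathIn

/-- Along any path in its domain, a solution is a damped path with damping `Φ_{AB}`. -/
theorem IsSolution.dampedPath {ν : ℝ → ℕ → EuclideanSpace ℝ (Fin n)} {t₀ : ℝ} {j₀ : ℕ}
    {E : Set (ℝ × ℕ)} {ζ : ℝ → ℕ → EuclideanSpace ℝ (Fin n)} (hζ : IsSolution D A B ν t₀ j₀ E ζ)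
    (hchain : ∀ p ∈ D, ∀ q ∈ D, p ≤ q ∨ q ≤ p) (hA : FlowMeasurable D A)
    (hc : ∀ t i, (t, i) ∈ D → ‖A t i‖ ≤ c) (hAB : StructuralProperties D A B)
    {j m : ℕ} {τ : ℕ → ℝ} (h : IsPathIn E j m τ) {M : ℝ}
    (hνflow : ∀ i ∈ Finset.Icc j m, ∀ t ∈ Ioo (τ i) (τ (i + 1)), ‖ν t i‖ ≤ M)
    (hνjump : ∀ i ∈ Finset.Ico j m, ‖ν (τ (i + 1)) i‖ ≤ M) :
    DampedPath (fun t i => Matrix.toEuclideanCLM (𝕜 := ℝ) (PhiAB D A B t i)) ζ c M j m τ := by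
  have hD : IsPathIn D j m τ := ⟨h.le, h.mono, fun i hi s hs => hζ.subset (h.mem i hi s hs)⟩
  have hPhi_jump : ∀ i ∈ Finset.Ico j m, PhiAB D A B (τ (i + 1)) i = B (τ (i + 1)) i :=
    fun i hi => if_neg (notMem_interior_flowInterval_of_jump hchain (hD.jump_mem hi).2)
  refine ⟨h.le, h.mono, fun i hi => hζ.arc i _ _ (h.mono i hi) (h.mem i hi), ?_, ?_, ?_, ?_, ?_⟩
  · intro i hi
    filter_upwards [hζ.flow i] with t ht hmem
    refine ⟨ν t i, hνflow i hi t hmem, ?_⟩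
    rw [hD.PhiAB_flow hi hmem]
    exact ht (h.Ioo_subset_interior hi hmem)
  · intro i hi
    obtain ⟨h1, h2⟩ := h.jump_mem hi
    refine ⟨ν (τ (i + 1)) i, hνjump i hi, ?_⟩
    rw [hPhi_jump i hi, hζ.jump _ _ h1 h2, map_sub, map_one]
    rfl
  · intro i hi t ht
    have hm := hD.mem i hi t (Ioo_subset_Icc_self ht)
    rw [hD.PhiAB_flow hi ht]
    exact ⟨isPositive_toEuclideanCLM (hAB t i hm).1, hc t i hm⟩
  · intro i hi
    have hm := (hD.jump_mem hi).1
    rw [hPhi_jump i hi]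
    exact ⟨isPositive_toEuclideanCLM (hAB _ i hm).2.1, (hAB _ i hm).2.2⟩
  · intro i hi
    exact continuous_toEuclideanCLM.comp_aestronglyMeasurable (hD.aestronglyMeasurable_PhiAB hA hi)

end Solution

/-! ### Iteration over windows -/

section Iteration

variable {n : ℕ} {D : Set (ℝ × ℕ)} {A B : ℝ → ℕ → Matrix (Fin n) (Fin n) ℝ}

/-- From any point `(s, k)` of a solution that precedes `(T, J)`: either the window at `(s, k)` ends
before `(T, J)`, and the energy contracts up to that end, or `(T, J)` is at distance at most `K + 1`
and the energy grows by a bounded factor only. -/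
theorem exists_window_step (hD : IsHybridTimeDomain D) (hA_meas : FlowMeasurable D A)
    (hA_bdd : UniformlyBounded D A) (hAB : StructuralProperties D A B) (hPE : HPE D A B) :
    ∃ K ρ C : ℝ, 0 < K ∧ 0 < ρ ∧ ρ < 1 ∧ 0 ≤ C ∧
    ∀ {ν : ℝ → ℕ → EuclideanSpace ℝ (Fin n)} {t₀ : ℝ} {j₀ : ℕ} {E : Set (ℝ × ℕ)}
      {ζ : ℝ → ℕ → EuclideanSpace ℝ (Fin n)}, IsSolution D A B ν t₀ j₀ E ζ →
    ∀ {T : ℝ} {J : ℕ} {M : ℝ}, (T, J) ∈ E → 0 ≤ M →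
      (∀ s i, (s, i) ∈ E → ¬ (T, J) ≤ (s, i) → ‖ν s i‖ ≤ M) →
    ∀ {s : ℝ} {k : ℕ}, (s, k) ∈ E → (s, k) ≤ (T, J) →
      (∃ s' k', (s', k') ∈ E ∧ (s', k') ≤ (T, J) ∧ K ≤ s' - s + ((k' : ℝ) - k) ∧
        s' - s + ((k' : ℝ) - k) ≤ K + 1 ∧ ‖ζ s' k'‖ ^ 2 ≤ ρ * ‖ζ s k‖ ^ 2 + C * M ^ 2) ∨
      (T - s + ((J : ℝ) - k) ≤ K + 1 ∧
        ‖ζ T J‖ ^ 2 ≤ Real.exp (K + 1) * (‖ζ s k‖ ^ 2 + 2 * M ^ 2)) := by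
  obtain ⟨K, hK, μ, hμ, hwin⟩ := hPE
  obtain ⟨c₀, -, hc₀⟩ := hA_bdd
  have hc : ∀ t i, (t, i) ∈ D → ‖A t i‖ ≤ max c₀ 1 := fun t i h =>
    (hc₀ t i h).trans (le_max_left _ _)
  obtain ⟨ρ, C, hρ0, hρ1, hC, hcontr⟩ := DampedPath.exists_contraction (EuclideanSpace ℝ (Fin n))
    (le_max_right c₀ 1) (show 0 < K + 1 by linarith) hμ
  refine ⟨K, ρ, C, hK, hρ0, hρ1, hC, ?_⟩
  intro ν t₀ j₀ E ζ hζ T J M hT hM hν s k hs hsT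
  obtain ⟨m, τ, hw, hpsd⟩ := hwin s k (hζ.subset hs)
  have hlen := hw.length_le hK
  -- a path that ends at or before `(T, J)` sees inputs of norm at most `M` only
  have hdamped : ∀ {m' : ℕ} {τ' : ℕ → ℝ}, IsPathIn E k m' τ' → (τ' (m' + 1), m') ≤ (T, J) →
      DampedPath (fun t i => Matrix.toEuclideanCLM (𝕜 := ℝ) (PhiAB D A B t i)) ζ (max c₀ 1) M
        k m' τ' := by
    intro m' τ' hpath hend
    rw [Prod.mk_le_mk] at hend
    refine hζ.dampedPath hD.chain hA_meas hc hAB hpath ?_ ?_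
    · intro i hi t ht
      refine hν t i (hpath.mem i hi t (Ioo_subset_Icc_self ht)) fun hle => ?_
      have h1 := (Prod.mk_le_mk.1 hle).1
      obtain ⟨hki, him⟩ := Finset.mem_Icc.1 hi
      have h2 : τ' (i + 1) ≤ τ' (m' + 1) :=
        monotoneOn_of_steps hpath.mono ⟨by lia, by lia⟩ ⟨by lia, le_rfl⟩ (by lia)
      linarith [ht.2, hend.1]
    · intro i hi
      refine hν _ i (hpath.jump_mem hi).1 fun hle => ?_
      have h1 := (Prod.mk_le_mk.1 hle).2
      have h2 := (Finset.mem_Ico.1 hi).2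
      lia
  have hpiece : ∀ i ∈ Finset.Icc k m, ∀ r ∈ Icc (τ i) (τ (i + 1)), (r, i) ≤ (T, J) →
      (r, i) ∈ E := by
    intro i hi r hr hle
    obtain ⟨hrD, hr0, -⟩ := hw.piece_mem hi hr
    exact hζ.domain.mem_of_le hζ.subset hD.chain hT hrD
      ((hζ.domain.start_le _ hs).trans hr0) hle
  by_cases hq : (τ (m + 1), m) ≤ (T, J)
  · left
    have hpath : IsPathIn E k m τ := ⟨hw.le, hw.mono, fun i hi r hr =>
      hpiece i hi r hr ((hw.piece_mem hi hr).2.2.trans hq)⟩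
    have hpathD : IsPathIn D k m τ :=
      ⟨hw.le, hw.mono, fun i hi r hr => (hw.piece_mem hi hr).1⟩
    have hm : m ∈ Finset.Icc k m := Finset.mem_Icc.2 ⟨hw.le, le_rfl⟩
    refine ⟨τ (m + 1), m, hpath.mem m hm _ ⟨hw.mono m hm, le_rfl⟩, hq, hw.length, ?_, ?_⟩
    · rwa [hw.start_eq] at hlen
    · have h1 := mul_norm_sq_le_of_posSemidef hpsd (ζ (τ k) k)
      rw [ContinuousLinearMap.map_hybridIntegral _ (hpathD.hybridIntegrable_PhiAB hA_meas hc)] at h1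
      have h2 := hcontr _ ζ M k m τ (hdamped hpath hq) hM hlen h1
      rwa [hw.start_eq] at h2
  · right
    have hTq : (T, J) ≤ (τ (m + 1), m) :=
      (hD.chain _ hw.end_mem _ (hζ.subset hT)).resolve_left hq
    obtain ⟨hJ, hTJ⟩ := hw.mem_piece (hζ.subset hT) hsT hTq
    obtain ⟨hkJ, hJm⟩ := Finset.mem_Icc.1 hJ
    have hTq' := Prod.mk_le_mk.1 hTq
    have hdist : T - s + ((J : ℝ) - k) ≤ K + 1 := by
      have : (J : ℝ) ≤ m := by exact_mod_cast hJm
      rw [hw.start_eq] at hlen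
      linarith [hTq'.1]
    refine ⟨hdist, ?_⟩
    -- the part of the window up to `(T, J)`
    have hpath : IsPathIn E k J (Function.update τ (J + 1) T) := by
      have hlow : ∀ i ∈ Finset.Icc k J, Function.update τ (J + 1) T i = τ i := fun i hi =>
        Function.update_of_ne (by have := (Finset.mem_Icc.1 hi).2; lia) _ _
      have hle : ∀ i ∈ Finset.Icc k J, i ∈ Finset.Icc k m ∧
          τ i ≤ Function.update τ (J + 1) T (i + 1) ∧
          Function.update τ (J + 1) T (i + 1) ≤ τ (i + 1) ∧
          Function.update τ (J + 1) T (i + 1) ≤ T := by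
        intro i hi
        obtain ⟨hki, hiJ⟩ := Finset.mem_Icc.1 hi
        have him : i ∈ Finset.Icc k m := Finset.mem_Icc.2 ⟨hki, hiJ.trans hJm⟩
        refine ⟨him, ?_⟩
        obtain rfl | hne := eq_or_ne i J
        · rw [Function.update_self]; exact ⟨hTJ.1, hTJ.2, le_rfl⟩
        · rw [Function.update_of_ne (by lia)]
          have : τ (i + 1) ≤ τ J :=
            monotoneOn_of_steps hw.mono ⟨by lia, by lia⟩ ⟨by lia, by lia⟩ (by lia)
          exact ⟨hw.mono i him, le_rfl, this.trans hTJ.1⟩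
      refine ⟨hkJ, fun i hi => ?_, fun i hi r hr => ?_⟩
      · rw [hlow i hi]; exact (hle i hi).2.1
      · rw [hlow i hi] at hr
        obtain ⟨him, -, h2, h3⟩ := hle i hi
        exact hpiece i him r ⟨hr.1, hr.2.trans h2⟩
          (Prod.mk_le_mk.2 ⟨hr.2.trans h3, (Finset.mem_Icc.1 hi).2⟩)
    have hstart : Function.update τ (J + 1) T k = s := by
      rw [Function.update_of_ne (by lia), hw.start_eq]
    have h1 := (hdamped hpath (by rw [Function.update_self])).norm_sq_end_le (L := K + 1) hM
      (by rwa [Function.update_self, hstart])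
    rwa [Function.update_self, hstart] at h1

/-- Exponential decay of the energy of solutions, up to the squared bound of the past input. -/
theorem exists_energy_estimate (hD : IsHybridTimeDomain D) (hA_meas : FlowMeasurable D A)
    (hA_bdd : UniformlyBounded D A) (hAB : StructuralProperties D A B) (hPE : HPE D A B) :
    ∃ κ γ lam : ℝ, 0 < κ ∧ 0 < γ ∧ 0 < lam ∧
    ∀ {ν : ℝ → ℕ → EuclideanSpace ℝ (Fin n)} {t₀ : ℝ} {j₀ : ℕ} {E : Set (ℝ × ℕ)}
      {ζ : ℝ → ℕ → EuclideanSpace ℝ (Fin n)}, IsSolution D A B ν t₀ j₀ E ζ →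
    ∀ {T : ℝ} {J : ℕ} {M : ℝ}, (T, J) ∈ E → 0 ≤ M →
      (∀ s i, (s, i) ∈ E → ¬ (T, J) ≤ (s, i) → ‖ν s i‖ ≤ M) →
      ‖ζ T J‖ ^ 2 ≤
        κ * Real.exp (-lam * (T - t₀ + ((J : ℝ) - j₀))) * ‖ζ t₀ j₀‖ ^ 2 + γ * M ^ 2 := by
  obtain ⟨K, ρ, C, hK, hρ0, hρ1, hC, hstep⟩ := exists_window_step hD hA_meas hA_bdd hAB hPE
  -- the rate for which `ρ = exp (-lam * (K + 1))`
  set lam : ℝ := -Real.log ρ / (K + 1) with hlam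
  have hlam0 : 0 < lam := div_pos (neg_pos.2 (Real.log_neg hρ0 hρ1)) (by linarith)
  have hρ : ∀ d ≤ K + 1, ρ ≤ Real.exp (-lam * d) := fun d hd => by
    rw [← Real.log_le_iff_le_exp hρ0]
    have h1 : lam * (K + 1) = -Real.log ρ := by rw [hlam]; field_simp
    nlinarith
  -- `C' * M ^ 2` is the fixed point of the recursion `V ↦ ρ * V + C * M ^ 2`
  set C' : ℝ := C / (1 - ρ) with hC'
  have h1ρ : 0 < 1 - ρ := by linarith
  have hC'0 : 0 ≤ C' := by positivity
  have hfix : C = C' * (1 - ρ) := by rw [hC']; field_simp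
  set e := Real.exp (K + 1) with he
  have he0 : 0 < e := Real.exp_pos _
  refine ⟨e / ρ, e * (C' + 2), lam, by positivity, by positivity, hlam0, ?_⟩
  intro ν t₀ j₀ E ζ hζ T J M hT hM hν
  have tail : ∀ {s : ℝ} {k : ℕ}, T - s + ((J : ℝ) - k) ≤ K + 1 ∧
        ‖ζ T J‖ ^ 2 ≤ e * (‖ζ s k‖ ^ 2 + 2 * M ^ 2) →
      ‖ζ T J‖ ^ 2 ≤ e / ρ * Real.exp (-lam * (T - s + ((J : ℝ) - k))) *
        max (‖ζ s k‖ ^ 2 - C' * M ^ 2) 0 + e * (C' + 2) * M ^ 2 := by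
    rintro s k ⟨hd, hV⟩
    set X := max (‖ζ s k‖ ^ 2 - C' * M ^ 2) 0
    have hX : 0 ≤ X := le_max_right _ _
    have hVX : ‖ζ s k‖ ^ 2 ≤ X + C' * M ^ 2 := by
      linarith [le_max_left (‖ζ s k‖ ^ 2 - C' * M ^ 2) 0]
    calc ‖ζ T J‖ ^ 2 ≤ e * (X + C' * M ^ 2 + 2 * M ^ 2) := hV.trans (by gcongr)
      _ = e / ρ * ρ * X + e * (C' + 2) * M ^ 2 := by field_simp; ring
      _ ≤ _ := by
        gcongr
        exact hρ _ hd
  have decay : ∀ N : ℕ, ∀ s k, (s, k) ∈ E → (s, k) ≤ (T, J) → T - s + ((J : ℝ) - k) ≤ N * K →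
      ‖ζ T J‖ ^ 2 ≤ e / ρ * Real.exp (-lam * (T - s + ((J : ℝ) - k))) *
        max (‖ζ s k‖ ^ 2 - C' * M ^ 2) 0 + e * (C' + 2) * M ^ 2 := by
    intro N
    induction N with
    | zero =>
      intro s k hs hle hd
      rcases hstep hζ hT hM hν hs hle with ⟨s', k', -, hle', hK', -⟩ | h
      · have h1 := (Prod.mk_le_mk.1 hle').1
        have h2 : (k' : ℝ) ≤ J := by exact_mod_cast (Prod.mk_le_mk.1 hle').2
        rw [Nat.cast_zero, zero_mul] at hd
        linarith
      · exact tail h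
    | succ N ih =>
      intro s k hs hle hd
      rcases hstep hζ hT hM hν hs hle with ⟨s', k', hs', hle', hK', hK1, hV⟩ | h
      · have h1 := ih s' k' hs' hle' (by push_cast at hd; linarith)
        refine h1.trans ?_
        have h2 : max (‖ζ s' k'‖ ^ 2 - C' * M ^ 2) 0 ≤
            ρ * max (‖ζ s k‖ ^ 2 - C' * M ^ 2) 0 := by
          refine max_le ?_ (mul_nonneg hρ0.le (le_max_right _ _))
          refine le_trans ?_ (mul_le_mul_of_nonneg_left (le_max_left _ _) hρ0.le)
          rw [hfix] at hV
          linarith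
        have h3 : Real.exp (-lam * (T - s' + ((J : ℝ) - k'))) * ρ ≤
            Real.exp (-lam * (T - s + ((J : ℝ) - k))) := by
          have : Real.exp (-lam * (T - s + ((J : ℝ) - k))) =
              Real.exp (-lam * (T - s' + ((J : ℝ) - k'))) *
                Real.exp (-lam * (s' - s + ((k' : ℝ) - k))) := by
            rw [← Real.exp_add]; ring_nf
          rw [this]
          gcongr
          exact hρ _ hK1
        set X := max (‖ζ s k‖ ^ 2 - C' * M ^ 2) 0
        have hX : 0 ≤ X := le_max_right _ _
        gcongr ?_ + _
        calc e / ρ * Real.exp (-lam * (T - s' + ((J : ℝ) - k'))) *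
              max (‖ζ s' k'‖ ^ 2 - C' * M ^ 2) 0
            ≤ e / ρ * Real.exp (-lam * (T - s' + ((J : ℝ) - k'))) * (ρ * X) := by gcongr
          _ = e / ρ * (Real.exp (-lam * (T - s' + ((J : ℝ) - k'))) * ρ) * X := by ring
          _ ≤ e / ρ * Real.exp (-lam * (T - s + ((J : ℝ) - k))) * X := by gcongr
      · exact tail h
  have hle := hζ.domain.start_le _ hT
  obtain ⟨N, hN⟩ := exists_nat_ge ((T - t₀ + ((J : ℝ) - j₀)) / K)
  refine (decay N t₀ j₀ hζ.domain.start_mem hle ((div_le_iff₀ hK).1 hN)).trans ?_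
  gcongr
  exact max_le (sub_le_self _ (by positivity)) (by positivity)

theorem exists_norm_estimate (hD : IsHybridTimeDomain D) (hA_meas : FlowMeasurable D A)
    (hA_bdd : UniformlyBounded D A) (hAB : StructuralProperties D A B) (hPE : HPE D A B) :
    ∃ κ γ lam : ℝ, 0 < κ ∧ 0 < γ ∧ 0 < lam ∧
    ∀ {ν : ℝ → ℕ → EuclideanSpace ℝ (Fin n)} {t₀ : ℝ} {j₀ : ℕ} {E : Set (ℝ × ℕ)}
      {ζ : ℝ → ℕ → EuclideanSpace ℝ (Fin n)}, IsSolution D A B ν t₀ j₀ E ζ →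
    ∀ {T : ℝ} {J : ℕ} {M : ℝ}, (T, J) ∈ E → 0 ≤ M →
      (∀ s i, (s, i) ∈ E → ¬ (T, J) ≤ (s, i) → ‖ν s i‖ ≤ M) →
      ‖ζ T J‖ ≤ κ * ‖ζ t₀ j₀‖ * Real.exp (-lam * (T + (J : ℝ) - t₀ - (j₀ : ℝ))) + γ * M := by
  obtain ⟨κ, γ, lam, hκ, hγ, hlam, hest⟩ := exists_energy_estimate hD hA_meas hA_bdd hAB hPE
  refine ⟨√κ, √γ, lam / 2, by positivity, by positivity, by positivity, ?_⟩
  intro ν t₀ j₀ E ζ hζ T J M hT hM hν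
  set a := √κ * ‖ζ t₀ j₀‖ * Real.exp (-(lam / 2) * (T + (J : ℝ) - t₀ - (j₀ : ℝ))) with ha
  have ha0 : 0 ≤ a := by positivity
  have ha2 : a ^ 2 = κ * Real.exp (-lam * (T - t₀ + ((J : ℝ) - j₀))) * ‖ζ t₀ j₀‖ ^ 2 := by
    rw [ha, mul_pow, mul_pow, Real.sq_sqrt hκ.le, ← Real.exp_nat_mul]
    push_cast
    ring_nf
  have hb2 : (√γ * M) ^ 2 = γ * M ^ 2 := by rw [mul_pow, Real.sq_sqrt hγ.le]
  have hb0 : 0 ≤ √γ * M := by positivity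
  have h := hest hζ hT hM hν
  rw [← ha2, ← hb2] at h
  refine (abs_le_of_sq_le_sq' (h.trans ?_) (by positivity)).2
  nlinarith [mul_nonneg ha0 hb0]

theorem isClassKInfty_const_mul {γ : ℝ} (hγ : 0 < γ) : IsClassKInfty fun r => γ * r where
  zero := mul_zero γ
  continuousOn := by fun_prop
  strictMonoOn := (strictMono_mul_left_of_pos hγ).strictMonoOn _
  tendsto_atTop := tendsto_id.const_mul_atTop hγ

theorem isClassKL_exp {κ lam : ℝ} (hκ : 0 < κ) (hlam : 0 < lam) :
    IsClassKL fun r s => κ * r * Real.exp (-lam * s) where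
  continuousOn := by fun_prop
  classK s _ :=
    { zero := by simp
      continuousOn := by fun_prop
      strictMonoOn := fun r _ r' _ h => by beta_reduce; gcongr }
  antitoneOn r hr s _ s' _ h := by
    have hr' : 0 ≤ r := hr
    have : -lam * s' ≤ -lam * s := by nlinarith
    beta_reduce
    gcongr
  tendsto_zero r _ := by
    have h : Tendsto (fun s : ℝ => -lam * s) atTop atBot :=
      tendsto_id.const_mul_atTop_of_neg (neg_lt_zero.2 hlam)
    simpa using (Real.tendsto_exp_atBot.comp h).const_mul (κ * r)

end Iteration

end

end HybridPE

theorem mainTheorem1 (n : ℕ) (D : Set (ℝ × ℕ)) (hD : HybridPE.IsHybridTimeDomain D)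
    (A B : ℝ → ℕ → Matrix (Fin n) (Fin n) ℝ)
    (hA_meas : HybridPE.FlowMeasurable D A)
    (hA_bdd : HybridPE.UniformlyBounded D A) (hB_bdd : HybridPE.UniformlyBounded D B)
    (hAB : HybridPE.StructuralProperties D A B)
    (hPE : HybridPE.HPE D A B) :
    HybridPE.OriginUES D A B ∧ HybridPE.ISS D A B := by
  obtain ⟨κ, γ, lam, hκ, hγ, hlam, hest⟩ :=
    HybridPE.exists_norm_estimate hD hA_meas hA_bdd hAB hPE
  refine ⟨⟨κ, hκ, lam, hlam, ?_⟩, ⟨fun r => γ * r, fun r s => κ * r * Real.exp (-lam * s),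
    HybridPE.isClassKInfty_const_mul hγ, HybridPE.isClassKL_exp hκ hlam, ?_⟩⟩
  · intro t₀ j₀ E ζ hζ t j ht
    simpa using hest hζ ht le_rfl (by simp)
  · intro ν t₀ j₀ E ζ hζ t j ht hbdd
    refine hest hζ ht (Real.sSup_nonneg ?_) fun s i hs hnot => le_csSup hbdd ⟨s, i, hs, hnot, rfl⟩
    rintro r ⟨s, i, -, -, rfl⟩
    exact norm_nonneg _
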